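/- Let $A\in\mathbb R^{n\times n}$, $B\in\mathbb R^{n\times m}$, and consider a leader $\dot x_0=Ax_0$ and $N$ followers $\dot x_i=Ax_i+Bu_i$, $i=1,\dots,N$, $t\ge0$. Let $\bar{\mathcal G}_1,\dots,\bar{\mathcal G}_{n_0}$ be directed graphs without self-loops on the nodes $0,1,\dots,N$, and let $\sigma:[0,\infty)\to\{1,\dots,n_0\}$ be constant on each interval $[t_j,t_{j+1})$, where $t_0=0$ and $t_{j+1}-t_j\ge\tau$ for all $j\ge 0$, for some $\tau>0$. Put $a_{ij}(t)=1$ if $(j,i)$ is an edge (from $j$ to $i$) of $\bar{\mathcal G}_{\sigma(t)}$ and $a_{ij}(t)=0$ otherwise. Let $\mathcal G_{\sigma(t)}$ be the subgraph of $\bar{\mathcal G}_{\sigma(t)}$ induced on $\{1,\dots,N\}$, $\mathcal L_{\sigma(t)}$ its Laplacian, $\mathcal H_{\sigma(t)}=\mathcal L_{\sigma(t)}+\mathrm{diag}\{a_{10}(t),\dots,a_{N0}(t)\}$, and $P_{\sigma(t)}$ the orthogonal projection of $\mathbb R^N$ onto $\ker\mathcal H_{\sigma(t)}$. Let $\|\cdot\|$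 be the Euclidean norm or the induced matrix norm, and let $\lambda_{\max}(A)$ be the largest real part of the eigenvalues of $A$. Assume: 1. $(A,B)$ is controllable; 2. $\mathcal G_{\sigma(t)}$ is undirected for all $t\ge0$; 3. there are $T_c>0$ and a subsequence $\{t_{j_k}\}_{k\ge0}$ of $\{t_j\}$ with $t_{j_0}=0$ and $t_{j_{k+1}}-t_{j_k}\le T_c$ such that, for every $k$, every node $i=1,\dots,N$ is reachable from node $0$ in the union graph $\bigcup_{t_j\in[t_{j_k},t_{j_{k+1}})}\bar{\mathcal G}_{\sigma(t_j)}$. Say that a gain $K\in\mathbb R^{m\times n}$ solves the leader-following exponential consensus problem if, under $u_i=K\sum_{j=0}^N a_{ij}(t)(x_j-x_i)$, $i=1,\dots,N$, the closed-loop system has a solution on $[0,\infty)$ for all initial conditions, and there are $c,\gamma>0$ such that every solution satisfies $\|x_i(t)-x_0(t)\|\le c\,e^{-\gamma t}\big(\sum_{j=1}^N\|x_j(0)-x_0(0)\|^2\big)^{1/2}$ for all $t\ge0$ and $i=1,\dots,N$. Then there is a number $\delta\in(0,1)$ with $$\big\|P_{\sigma(t_{j_{k+1}-1})}\cdots P_{\sigma(t_{j_k+1})}P_{\sigma(t_{j_k})}\big\|\le\delta\quad\text{for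 all }k\ge0,\qquad(*)$$ and for every $\delta\in(0,1)$ satisfying $(*)$, if $$\lambda_{\max}(A)<-\frac{\ln\delta}{T_c},$$ then some $K$ solves the leader-following exponential consensus problem. More precisely, put $W_c(\alpha,t^*)=\int_0^{t^*}e^{-\alpha t}e^{-\frac A2t}BB^Te^{-\frac{A^T}2t}\,dt$ and $\lambda_H=\frac{4}{N(N^2-N+4)}$. Then for every $t^*>0$ there is $\alpha_0>0$ such that, for all $\alpha>\alpha_0$, $W_c(\alpha,t^*)$ is positive definite and, for all $\mu\ge1/\lambda_H$, the gain $K=\mu B^TW_c^{-1}(\alpha,t^*)$ solves the problem. -/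

import Mathlib

noncomputable section

namespace LeaderFollowing

/-- A piecewise constant switching signal with values in `P`, together with its switching
instants `t 0 = 0 < t 1 < ...` and a dwell time `τ > 0`.  Only the values of `σ` on `[0, ∞)`
are used. -/
structure SwitchingSignal (P : Type*) where
  σ : ℝ → P
  t : ℕ → ℝ
  τ : ℝ
  τ_pos : 0 < τ
  t_zero : t 0 = 0
  dwell : ∀ j, τ ≤ t (j + 1) - t j
  const : ∀ j, ∀ s ∈ Set.Ico (t j) (t (j + 1)), σ s = σ (t j)

open Classical in
/-- Adjacency matrix `[a i j]`: `a i j = 1` if `(j, i)` is an edge (from `j` to `i`), else `0`. -/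
def adjacency {V : Type*} (G : Digraph V) : Matrix V V ℝ :=
  Matrix.of fun i j => if G.Adj j i then 1 else 0

/-- Laplacian: `l i i = ∑ j, a i j` and `l i j = - a i j` for `i ≠ j`
(for graphs without self-loops). -/
def laplacian {V : Type*} [Fintype V] [DecidableEq V] (G : Digraph V) : Matrix V V ℝ :=
  Matrix.diagonal (fun i => ∑ j, adjacency G i j) - adjacency G

/-- The subgraph induced on the followers; the leader is node `0` of `Fin (N + 1)` and the
followers are the nodes `Fin.succ i`, `i : Fin N`. -/
def followerSubgraph {N : ℕ} (G : Digraph (Fin (N + 1))) : Digraph (Fin N) where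
  Adj i j := G.Adj i.succ j.succ

/-- The leader-follower matrix `H = L + Δ`, where `L` is the Laplacian of the follower subgraph
and `Δ = diag (a 1 0, ..., a N 0)`. -/
def leaderFollowerMatrix {N : ℕ} (G : Digraph (Fin (N + 1))) : Matrix (Fin N) (Fin N) ℝ :=
  laplacian (followerSubgraph G) + Matrix.diagonal (fun i => adjacency G i.succ 0)

/-- A digraph is undirected if every edge is reversible. -/
def IsUndirected {V : Type*} (G : Digraph V) : Prop :=
  ∀ i j, G.Adj i j → G.Adj j i

/-- `i` is reachable from `r`: there is a path `(r, i₁), (i₁, i₂), ..., (iₖ, i)` of edges. -/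
def Reachable {V : Type*} (G : Digraph V) (r i : V) : Prop :=
  Relation.TransGen G.Adj r i

/-- The union of the graphs active at the switching instants lying in `[a, b)`. -/
def unionGraph {P V : Type*} (S : SwitchingSignal P) (G : P → Digraph V) (a b : ℝ) : Digraph V :=
  ⨆ j : {j : ℕ // S.t j ∈ Set.Ico a b}, G (S.σ (S.t j))

/-- Joint connectivity along the subsequence `t (jk 0) = 0, t (jk 1), ...` of switching instants,
with windows of length at most `Tc`. -/
structure JointlyConnected {P : Type*} {N : ℕ} (S : SwitchingSignal P)
    (G : P → Digraph (Fin (N + 1))) (jk : ℕ → ℕ) (Tc : ℝ) : Prop where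
  Tc_pos : 0 < Tc
  strictMono : StrictMono jk
  start : S.t (jk 0) = 0
  window : ∀ k, S.t (jk (k + 1)) - S.t (jk k) ≤ Tc
  reachable : ∀ k, ∀ i : Fin N,
    Reachable (unionGraph S G (S.t (jk k)) (S.t (jk (k + 1)))) 0 i.succ

/-- Orthogonal projection of `ℝ^N` (Euclidean) onto `ker H`. -/
def kerProj {N : ℕ} (H : Matrix (Fin N) (Fin N) ℝ) :
    EuclideanSpace ℝ (Fin N) →L[ℝ] EuclideanSpace ℝ (Fin N) :=
  (LinearMap.ker (Matrix.toEuclideanLin H)).starProjection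

/-- The ordered product `F (a + l - 1) * ... * F (a + 1) * F a` of `l` factors. -/
def orderedProd {M : Type*} [Monoid M] (F : ℕ → M) (a : ℕ) : ℕ → M
  | 0 => 1
  | l + 1 => F (a + l) * orderedProd F a l

/-- For every `k`, the operator norm of the product of the projections onto the kernels of the
leader-follower matrices, taken over the indices `jk k, ..., jk (k + 1) - 1`
(later factors on the left), is at most `δ`. -/
def ProjectionProductsBounded {P : Type*} {N : ℕ} (S : SwitchingSignal P)
    (G : P → Digraph (Fin (N + 1))) (jk : ℕ → ℕ) (δ : ℝ) : Prop :=
  ∀ k, ‖orderedProd (fun r => kerProj (leaderFollowerMatrix (G (S.σ (S.t r)))))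
    (jk k) (jk (k + 1) - jk k)‖ ≤ δ

/-- The largest real part of the (complex) eigenvalues of a real square matrix. -/
def lambdaMax {n : ℕ} (A : Matrix (Fin n) (Fin n) ℝ) : ℝ :=
  sSup (Complex.re '' spectrum ℂ (A.map (fun a : ℝ => (a : ℂ))))

/-- `(A, B)` is controllable: the controllability matrix `[B, AB, ..., A^(n-1) B]` has rank `n`. -/
def Controllable {n m : ℕ} (A : Matrix (Fin n) (Fin n) ℝ) (B : Matrix (Fin n) (Fin m) ℝ) : Prop :=
  (Matrix.of fun (i : Fin n) (p : Fin n × Fin m) => (A ^ (p.1 : ℕ) * B) i p.2).rank = n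

/-- Weighted controllability Gramian
`W_c(α, T) = ∫_0^T e^{-α s} e^{-(A/2) s} B Bᵀ e^{-(Aᵀ/2) s} ds` (entrywise integral). -/
def gramian {n m : ℕ} (A : Matrix (Fin n) (Fin n) ℝ) (B : Matrix (Fin n) (Fin m) ℝ) (α T : ℝ) :
    Matrix (Fin n) (Fin n) ℝ :=
  Matrix.of fun i j => ∫ s in (0 : ℝ)..T,
    (Real.exp (-α * s) • (NormedSpace.exp ((-(s / 2)) • A) * B * B.transpose *
      NormedSpace.exp ((-(s / 2)) • A.transpose))) i j

/-- `λ_H = 4 / (N (N² - N + 4))`. -/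
def lambdaH (N : ℕ) : ℝ :=
  4 / ((N : ℝ) * ((N : ℝ) ^ 2 - (N : ℝ) + 4))

/-- The distributed static state feedback `u_i = K ∑_{j=0}^N a_{ij} (x_j - x_i)` of follower `i`,
for the network graph `G` and agent states `x`. -/
def feedback {N n m : ℕ} (G : Digraph (Fin (N + 1))) (K : Matrix (Fin m) (Fin n) ℝ)
    (x : Fin (N + 1) → EuclideanSpace ℝ (Fin n)) (i : Fin N) : EuclideanSpace ℝ (Fin m) :=
  Matrix.toEuclideanLin K (∑ j : Fin (N + 1), adjacency G i.succ j • (x j - x i.succ))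

/-- `x` is a solution on `[0, ∞)` of the closed-loop system formed by the leader
`x_0' = A x_0` and the followers `x_i' = A x_i + B u_i` under the switched feedback: it is
continuous, and the follower equations hold on every interval `[t j, t (j+1))`
(with the right derivative at `t j`). -/
structure IsClosedLoopSolution {P : Type*} {N n m : ℕ} (S : SwitchingSignal P)
    (G : P → Digraph (Fin (N + 1))) (A : Matrix (Fin n) (Fin n) ℝ)
    (B : Matrix (Fin n) (Fin m) ℝ) (K : Matrix (Fin m) (Fin n) ℝ)
    (x : Fin (N + 1) → ℝ → EuclideanSpace ℝ (Fin n)) : Prop where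
  continuousOn : ∀ i, ContinuousOn (x i) (Set.Ici 0)
  leader : ∀ s ∈ Set.Ici (0 : ℝ),
    HasDerivWithinAt (x 0) (Matrix.toEuclideanLin A (x 0 s)) (Set.Ici 0) s
  follower : ∀ i : Fin N, ∀ j : ℕ, ∀ s ∈ Set.Ico (S.t j) (S.t (j + 1)),
    HasDerivWithinAt (x i.succ)
      (Matrix.toEuclideanLin A (x i.succ s) +
        Matrix.toEuclideanLin B (feedback (G (S.σ s)) K (fun k => x k s) i))
      (Set.Ico (S.t j) (S.t (j + 1))) s

/-- The gain `K` solves the leader-following exponential consensus problem: from every initial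
condition the closed-loop system has a solution on `[0, ∞)`, and the consensus errors
`x_i - x_0` of all solutions converge to zero exponentially, with a rate `γ` and a constant `c`
that do not depend on the solution. -/
def SolvesConsensus {P : Type*} {N n m : ℕ} (S : SwitchingSignal P)
    (G : P → Digraph (Fin (N + 1))) (A : Matrix (Fin n) (Fin n) ℝ)
    (B : Matrix (Fin n) (Fin m) ℝ) (K : Matrix (Fin m) (Fin n) ℝ) : Prop :=
  (∀ ξ : Fin (N + 1) → EuclideanSpace ℝ (Fin n),
    ∃ x, IsClosedLoopSolution S G A B K x ∧ ∀ i, x i 0 = ξ i) ∧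
  ∃ c > 0, ∃ γ > 0, ∀ x, IsClosedLoopSolution S G A B K x →
    ∀ i : Fin N, ∀ s ≥ 0,
      ‖x i.succ s - x 0 s‖ ≤
        c * Real.exp (-γ * s) * Real.sqrt (∑ j : Fin N, ‖x j.succ 0 - x 0 0‖ ^ 2)

end LeaderFollowing

end

/-! Stack the consensus errors as the rows of a matrix `Z`. Between switches `Z' = Z Aᵀ - H Z (B
K)ᵀ`, and `H` is symmetric, so with `P` the projection onto `ker H` the parts `P Z` and `(1 - P) Z`
decouple.

On the kernel part feedback has no effect: `P Z` is multiplied by an exponential of `Aᵀ`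
(`SolvesErrorEquation.mul_eq_mul_exp`). On the complement, the spectral gap of `H`
(`dotProduct_self_le_energy`) and the Lyapunov inequality of the Gramian (`gramian_lyapunov`) make
the quadratic form of `W⁻¹` decay at rate `2 α`. Comparing this form with the Euclidean norm costs a
factor exponential in `α`, but evaluating the Gramian bound on a time at most `τ` keeps the cost at
`exp (α τ / 2)`. After a dwell time a factor of order `exp (-α τ / 2)` remains, with a constant
independent of `α` and `μ` (`exists_norm_one_sub_kerProjMatrix_mul_le`).

Hence, for large `α`, sampling at the switching instants gives nearly `Z ↦ P Z exp (h Aᵀ)`.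
Projections act on the left and exponentials on the right, so along a block the map is the ordered
product of projections times a single exponential, up to a small error
(`norm_sub_orderedProd_mul_exp_le`). Each window contributes a factor `δ` from the projections and,
up to one constant per block, `exp (ρ Tc)` from the exponential, where `λ_max(A) < ρ < -ln δ / Tc`.
A block of enough windows therefore halves the error (`exists_norm_le_mul_exp_mul`).

A suitable `δ` exists because a vector whose norm survives all projections of a window lies in every
kernel, and joint connectivity forces it to vanish. Only finitely many products occur, so the bound
is uniform over windows. -/

noncomputable section

namespace LeaderFollowing

open Matrix

/-! ### Dirichlet energy and the spectral gap of leader-follower matrices -/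

section LeaderFollowerGraphs

/-- Along a path, the squared difference of a vertex function is at most the length of the path
times the Dirichlet energy of the function on the support of the path. -/
theorem sq_sub_le_length_mul_energy_support {V : Type*} [DecidableEq V]
    (Γ : SimpleGraph V) [DecidableRel Γ.Adj] (y : V → ℝ) {u v : V} (p : Γ.Walk u v)
    (hp : p.IsPath) :
    (y u - y v) ^ 2 ≤ p.length * ((∑ i ∈ p.support.toFinset, ∑ j ∈ p.support.toFinset,
      if Γ.Adj i j then (y i - y j) ^ 2 else 0) / 2) := by
  induction p with
  | nil => simp
  | @cons u w v h q ih =>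
    rw [SimpleGraph.Walk.cons_isPath_iff] at hp
    have ih := ih hp.1
    have hu : u ∉ q.support.toFinset := by simpa using hp.2
    have hw : w ∈ q.support.toFinset := by simp
    set s := q.support.toFinset
    set f : V → V → ℝ := fun i j => if Γ.Adj i j then (y i - y j) ^ 2 else 0 with hf
    have hf0 : ∀ i j, 0 ≤ f i j := fun i j => by simp only [hf]; split_ifs <;> positivity
    -- The head `u` is not on the tail, so the edge `u w` contributes new energy, once in each
    -- orientation.
    have hE : (∑ i ∈ s, ∑ j ∈ s, f i j) / 2 + (y u - y w) ^ 2 ≤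
        (∑ i ∈ insert u s, ∑ j ∈ insert u s, f i j) / 2 := by
      have e1 : f u w = (y u - y w) ^ 2 := by simp [hf, h]
      have e2 : f w u = (y u - y w) ^ 2 := by simp only [hf, if_pos h.symm]; ring
      have h1 : f u w ≤ ∑ j ∈ s, f u j := Finset.single_le_sum (fun j _ => hf0 u j) hw
      have h2 : f w u ≤ ∑ i ∈ s, f i u := Finset.single_le_sum (fun i _ => hf0 i u) hw
      have h3 := hf0 u u
      simp only [Finset.sum_insert hu, Finset.sum_add_distrib]
      linarith
    have hs : (SimpleGraph.Walk.cons h q).support.toFinset = insert u s := by simp [s]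
    rw [hs, SimpleGraph.Walk.length_cons]
    set E := (∑ i ∈ s, ∑ j ∈ s, f i j) / 2
    have hE0 : 0 ≤ E := by
      have : 0 ≤ ∑ i ∈ s, ∑ j ∈ s, f i j :=
        Finset.sum_nonneg fun i _ => Finset.sum_nonneg fun j _ => hf0 i j
      positivity
    set l : ℝ := (q.length : ℝ)
    have hl : 0 ≤ l := Nat.cast_nonneg _
    set a := y u - y w
    set b := y w - y v
    have hab : y u - y v = a + b := by simp only [a, b]; ring
    -- AM-GM with `b² ≤ l E`: `(2ab)² ≤ 4 (l a²) E ≤ (l a² + E)²`.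
    have h2ab : 2 * a * b ≤ l * a ^ 2 + E := by
      refine (le_abs_self _).trans (abs_le_of_sq_le_sq ?_ (by positivity))
      nlinarith [sq_nonneg (l * a ^ 2 - E), mul_le_mul_of_nonneg_left ih (sq_nonneg a)]
    have hl1 : ((q.length + 1 : ℕ) : ℝ) = l + 1 := by push_cast; rfl
    rw [hab, hl1]
    calc (a + b) ^ 2 ≤ (l + 1) * (E + a ^ 2) := by nlinarith
      _ ≤ _ := by gcongr

theorem sq_sub_le_length_mul_energy {V : Type*} [DecidableEq V] [Fintype V]
    (Γ : SimpleGraph V) [DecidableRel Γ.Adj] (y : V → ℝ) {u v : V} (p : Γ.Walk u v)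
    (hp : p.IsPath) :
    (y u - y v) ^ 2 ≤
      p.length * ((∑ i, ∑ j, if Γ.Adj i j then (y i - y j) ^ 2 else 0) / 2) := by
  refine (sq_sub_le_length_mul_energy_support Γ y p hp).trans ?_
  have h0 : ∀ i j, 0 ≤ (if Γ.Adj i j then (y i - y j) ^ 2 else 0) := fun i j => by
    split_ifs <;> positivity
  gcongr
  refine (Finset.sum_le_sum fun i _ => Finset.sum_le_sum_of_subset_of_nonneg
    (Finset.subset_univ _) fun j _ _ => h0 i j).trans ?_
  exact Finset.sum_le_sum_of_subset_of_nonneg (Finset.subset_univ _)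
    fun i _ _ => Finset.sum_nonneg fun j _ => h0 i j

variable {N : ℕ} {G : Digraph (Fin (N + 1))}

theorem adjacency_nonneg {V : Type*} (G : Digraph V) (i j : V) : 0 ≤ adjacency G i j := by
  simp only [adjacency, of_apply]; split_ifs <;> norm_num

theorem adjacency_comm {V : Type*} {G : Digraph V} (h : IsUndirected G) (i j : V) :
    adjacency G i j = adjacency G j i := by
  have : G.Adj j i ↔ G.Adj i j := ⟨h j i, h i j⟩
  by_cases hij : G.Adj i j
  · simp [adjacency, hij, this.2 hij]
  · simp [adjacency, hij, mt this.1 hij]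

theorem leaderFollowerMatrix_mulVec_apply (G : Digraph (Fin (N + 1))) (x : Fin N → ℝ)
    (i : Fin N) :
    (leaderFollowerMatrix G *ᵥ x) i =
      ∑ j, adjacency (followerSubgraph G) i j * (x i - x j) + adjacency G i.succ 0 * x i := by
  simp only [leaderFollowerMatrix, laplacian, add_mulVec, sub_mulVec, Pi.add_apply, Pi.sub_apply,
    mulVec_diagonal]
  simp only [mulVec, dotProduct, mul_sub, Finset.sum_sub_distrib, Finset.sum_mul]

theorem leaderFollowerMatrix_isSymm (h : IsUndirected (followerSubgraph G)) :
    (leaderFollowerMatrix G)ᵀ = leaderFollowerMatrix G := by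
  have h2 : (adjacency (followerSubgraph G))ᵀ = adjacency (followerSubgraph G) := by
    ext i j; exact adjacency_comm h j i
  simp [leaderFollowerMatrix, laplacian, h2]

theorem dotProduct_leaderFollowerMatrix_mulVec (h : IsUndirected (followerSubgraph G))
    (x : Fin N → ℝ) :
    x ⬝ᵥ (leaderFollowerMatrix G *ᵥ x) =
      (∑ i, ∑ j, adjacency (followerSubgraph G) i j * (x i - x j) ^ 2) / 2 +
        ∑ i, adjacency G i.succ 0 * x i ^ 2 := by
  simp only [dotProduct, leaderFollowerMatrix_mulVec_apply, mul_add, Finset.sum_add_distrib,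
    Finset.mul_sum]
  congr 1
  · have h1 : ∑ i, ∑ j, x i * (adjacency (followerSubgraph G) i j * (x i - x j)) =
        ∑ i, ∑ j, x j * (adjacency (followerSubgraph G) i j * (x j - x i)) := by
      rw [Finset.sum_comm]
      refine Finset.sum_congr rfl fun i _ => Finset.sum_congr rfl fun j _ => ?_
      rw [adjacency_comm h]
    have h2 : ∑ i, ∑ j, adjacency (followerSubgraph G) i j * (x i - x j) ^ 2 =
        ∑ i, ∑ j, x i * (adjacency (followerSubgraph G) i j * (x i - x j)) +
        ∑ i, ∑ j, x j * (adjacency (followerSubgraph G) i j * (x j - x i)) := by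
      simp only [← Finset.sum_add_distrib]
      refine Finset.sum_congr rfl fun i _ => Finset.sum_congr rfl fun j _ => ?_
      ring
    rw [h2, ← h1]; ring
  · refine Finset.sum_congr rfl fun i _ => ?_
    ring

/-- The undirected graph on all nodes obtained from a leader-follower graph by forgetting the
edges that enter the leader. -/
def leaderGraph (G : Digraph (Fin (N + 1))) : SimpleGraph (Fin (N + 1)) :=
  SimpleGraph.fromRel fun a b => G.Adj a b ∧ b ≠ 0

theorem leaderGraph_adj_succ (h : IsUndirected (followerSubgraph G)) (hl : ∀ i, ¬ G.Adj i i)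
    (i j : Fin N) : (leaderGraph G).Adj i.succ j.succ ↔ G.Adj j.succ i.succ := by
  have hij : G.Adj i.succ j.succ ↔ G.Adj j.succ i.succ := ⟨h i j, h j i⟩
  simp only [leaderGraph, SimpleGraph.fromRel_adj, ne_eq, Fin.succ_ne_zero, not_false_eq_true,
    and_true, hij, or_self, and_iff_right_iff_imp]
  rintro h1 h2
  rw [h2] at h1
  exact hl _ h1

theorem leaderGraph_adj_zero (j : Fin N) :
    (leaderGraph G).Adj 0 j.succ ↔ G.Adj 0 j.succ := by
  simp [leaderGraph, SimpleGraph.fromRel_adj, (Fin.succ_ne_zero j).symm]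

open Classical in
theorem energy_leaderGraph (h : IsUndirected (followerSubgraph G)) (hl : ∀ i, ¬ G.Adj i i)
    (x : Fin N → ℝ) :
    (∑ i, ∑ j, if (leaderGraph G).Adj i j then
      ((Fin.cons 0 x : Fin (N + 1) → ℝ) i - (Fin.cons 0 x : Fin (N + 1) → ℝ) j) ^ 2 else 0) / 2 =
      x ⬝ᵥ (leaderFollowerMatrix G *ᵥ x) := by
  have h2 : ∀ i : Fin N, (leaderGraph G).Adj i.succ 0 ↔ G.Adj 0 i.succ := fun i => by
    rw [SimpleGraph.adj_comm, leaderGraph_adj_zero]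
  have h3 : ∀ (i j : Fin N) (t : ℝ), adjacency (followerSubgraph G) i j * t =
      if G.Adj j.succ i.succ then t else 0 := fun i j t => by
    by_cases hij : G.Adj j.succ i.succ <;> simp [adjacency, followerSubgraph, hij]
  have h4 : ∀ (i : Fin N) (t : ℝ), adjacency G i.succ 0 * t =
      if G.Adj 0 i.succ then t else 0 := fun i t => by
    by_cases hi : G.Adj 0 i.succ <;> simp [adjacency, hi]
  rw [dotProduct_leaderFollowerMatrix_mulVec h]
  simp only [Fin.sum_univ_succ, Fin.cons_zero, Fin.cons_succ, leaderGraph_adj_succ h hl, h2, h3, h4,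
    leaderGraph_adj_zero, Finset.sum_add_distrib]
  simp only [SimpleGraph.irrefl, if_false, zero_sub, sub_zero, neg_sq]
  ring

open Classical in
-- Each follower is compared, along a path, with a vertex where the function is zero or has the
-- opposite sign. The leader, given the value `0`, serves in its own component; in any other
-- component, orthogonality to the kernel makes the sum of `x` zero, so a sign change exists.
theorem dotProduct_self_le_energy (h : IsUndirected (followerSubgraph G))
    (hl : ∀ i, ¬ G.Adj i i) (x : Fin N → ℝ)
    (hx : ∀ v, leaderFollowerMatrix G *ᵥ v = 0 → v ⬝ᵥ x = 0) :
    x ⬝ᵥ x ≤ ((N : ℝ) ^ 2 - N + 1) * (x ⬝ᵥ (leaderFollowerMatrix G *ᵥ x)) := by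
  set E := x ⬝ᵥ (leaderFollowerMatrix G *ᵥ x) with hE
  set y : Fin (N + 1) → ℝ := Fin.cons 0 x with hy
  have hEn : E = (∑ i, ∑ j, if (leaderGraph G).Adj i j then (y i - y j) ^ 2 else 0) / 2 :=
    (energy_leaderGraph h hl x).symm
  have hE0 : 0 ≤ E := by
    rw [hEn]
    refine div_nonneg (Finset.sum_nonneg fun i _ => Finset.sum_nonneg fun j _ => ?_) (by norm_num)
    split_ifs <;> positivity
  have hpath : ∀ {u v : Fin (N + 1)} (p : (leaderGraph G).Walk u v), p.IsPath →
      (y u - y v) ^ 2 ≤ p.length * E := fun p hp => by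
    rw [hEn]; exact sq_sub_le_length_mul_energy _ y p hp
  have hreach : ∀ i : Fin N, (leaderGraph G).Reachable 0 i.succ → x i ^ 2 ≤ N * E := by
    rintro i hi
    obtain ⟨p, hp⟩ := hi.exists_isPath
    have h1 := hpath p hp
    have h2 := hp.length_lt
    simp only [Fintype.card_fin] at h2
    have h3 : (p.length : ℝ) ≤ N := by exact_mod_cast Nat.lt_succ_iff.mp h2
    simp only [hy, Fin.cons_zero, Fin.cons_succ, zero_sub, neg_sq] at h1
    exact h1.trans (by gcongr)
  have hunreach : ∀ i : Fin N, ¬ (leaderGraph G).Reachable 0 i.succ →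
      x i ^ 2 ≤ ((N : ℝ) - 1) * E := by
    intro i hi
    -- The indicator of a component without the leader lies in the kernel.
    let v : Fin N → ℝ := fun j => if (leaderGraph G).Reachable i.succ j.succ then 1 else 0
    have hv : leaderFollowerMatrix G *ᵥ v = 0 := by
      ext j
      rw [leaderFollowerMatrix_mulVec_apply, Pi.zero_apply]
      have h1 : ∀ k, adjacency (followerSubgraph G) j k * (v j - v k) = 0 := by
        intro k
        by_cases hk : G.Adj k.succ j.succ
        · have h2 : (leaderGraph G).Reachable j.succ k.succ :=
            ((leaderGraph_adj_succ h hl j k).2 hk).reachable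
          have : v j = v k := by
            simp only [v]
            congr 1
            exact propext ⟨fun h3 => h3.trans h2, fun h3 => h3.trans h2.symm⟩
          rw [this, sub_self, mul_zero]
        · simp [adjacency, followerSubgraph, hk]
      have h2 : adjacency G j.succ 0 * v j = 0 := by
        by_cases hk : G.Adj 0 j.succ
        · have h2 : (leaderGraph G).Reachable 0 j.succ := ((leaderGraph_adj_zero j).2 hk).reachable
          have : v j = 0 := if_neg fun h3 => hi (h2.trans h3.symm)
          rw [this, mul_zero]
        · simp [adjacency, hk]
      simp [h1, h2]
    have hvx := hx v hv
    obtain ⟨j, hj, hij⟩ : ∃ j, (leaderGraph G).Reachable i.succ j.succ ∧ x i * x j ≤ 0 := by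
      by_contra! hcon
      have : 0 < ∑ j, x i * (v j * x j) := by
        refine Finset.sum_pos' (fun j _ => ?_) ⟨i, Finset.mem_univ _, ?_⟩
        · by_cases hj : (leaderGraph G).Reachable i.succ j.succ
          · simpa [v, hj] using (hcon j hj).le
          · simp [v, hj]
        · simpa [v] using hcon i (SimpleGraph.Reachable.refl _)
      rw [← Finset.mul_sum] at this
      simp only [dotProduct] at hvx
      rw [hvx, mul_zero] at this
      exact lt_irrefl _ this
    obtain ⟨p, hp⟩ := hj.exists_isPath
    have h1 := hpath p hp
    -- The path avoids the leader, which saves one edge compared with the reachable case.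
    have h2 : p.length + 1 ≤ N := by
      have h3 : p.support.toFinset ⊆ Finset.univ.erase 0 := by
        intro w hw
        rw [Finset.mem_erase]
        refine ⟨?_, Finset.mem_univ _⟩
        rintro rfl
        rw [List.mem_toFinset] at hw
        exact hi ⟨(p.takeUntil 0 hw).reverse⟩
      have h4 := Finset.card_le_card h3
      rwa [List.toFinset_card_of_nodup hp.support_nodup, SimpleGraph.Walk.length_support,
        Finset.card_erase_of_mem (Finset.mem_univ _), Finset.card_univ, Fintype.card_fin,
        Nat.add_sub_cancel] at h4
    have h3 : (p.length : ℝ) ≤ (N : ℝ) - 1 := by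
      have : ((p.length + 1 : ℕ) : ℝ) ≤ N := by exact_mod_cast h2
      push_cast at this; linarith
    simp only [hy, Fin.cons_succ] at h1
    calc x i ^ 2 ≤ (x i - x j) ^ 2 := by nlinarith [sq_nonneg (x j)]
      _ ≤ _ := h1.trans (by gcongr)
  have hall : ∀ i, x i ^ 2 ≤ N * E := fun i => by
    by_cases hi : (leaderGraph G).Reachable 0 i.succ
    · exact hreach i hi
    · exact (hunreach i hi).trans (by nlinarith)
  have hself : x ⬝ᵥ x = ∑ i, x i ^ 2 := by simp [dotProduct, sq]
  rw [hself]
  -- With a follower adjacent to the leader the count is `1 + (N - 1) N`; otherwise no follower is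
  -- reachable and it is `N (N - 1)`.
  by_cases hpin : ∃ i : Fin N, G.Adj 0 i.succ
  · obtain ⟨i, hi⟩ := hpin
    have h1 : x i ^ 2 ≤ E := by
      have := hpath (((leaderGraph_adj_zero i).2 hi).toWalk)
        (by simp [SimpleGraph.Adj.toWalk, (Fin.succ_ne_zero i).symm])
      simpa [hy] using this
    rw [← Finset.add_sum_erase _ _ (Finset.mem_univ i)]
    have h2 := Finset.sum_le_card_nsmul (Finset.univ.erase i) (fun j => x j ^ 2) (N * E)
      fun j _ => hall j
    rw [Finset.card_erase_of_mem (Finset.mem_univ _), Finset.card_univ, Fintype.card_fin,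
      nsmul_eq_mul, Nat.cast_sub (Nat.one_le_iff_ne_zero.2 (by rintro rfl; exact i.elim0))] at h2
    push_cast at h2
    nlinarith
  · have hnr : ∀ i : Fin N, ¬ (leaderGraph G).Reachable 0 i.succ := by
      rintro i ⟨p⟩
      cases p with
      | @cons _ w _ hw q =>
        rcases Fin.eq_zero_or_eq_succ w with rfl | ⟨k, rfl⟩
        · exact (leaderGraph G).irrefl hw
        · exact hpin ⟨k, (leaderGraph_adj_zero k).1 hw⟩
    have h2 := Finset.sum_le_card_nsmul Finset.univ (fun j => x j ^ 2) (((N : ℝ) - 1) * E)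
      fun j _ => hunreach j (hnr j)
    rw [Finset.card_univ, Fintype.card_fin, nsmul_eq_mul] at h2
    nlinarith

/-- The eigenvalues of a leader-follower matrix that are not zero are at least `lambdaH`. -/
theorem dotProduct_self_le_of_inv_lambdaH_le (h : IsUndirected (followerSubgraph G))
    (hl : ∀ i, ¬ G.Adj i i) {μ : ℝ} (hμ : 1 / lambdaH N ≤ μ) (x : Fin N → ℝ)
    (hx : ∀ v, leaderFollowerMatrix G *ᵥ v = 0 → v ⬝ᵥ x = 0) :
    x ⬝ᵥ x ≤ μ * (x ⬝ᵥ (leaderFollowerMatrix G *ᵥ x)) := by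
  rcases Nat.eq_zero_or_pos N with rfl | hN
  · simp [dotProduct]
  have hE0 : 0 ≤ x ⬝ᵥ (leaderFollowerMatrix G *ᵥ x) := by
    rw [dotProduct_leaderFollowerMatrix_mulVec h]
    have h1 := adjacency_nonneg (followerSubgraph G)
    have h2 := adjacency_nonneg G
    refine add_nonneg (div_nonneg (Finset.sum_nonneg fun i _ => Finset.sum_nonneg fun j _ =>
      mul_nonneg (h1 _ _) (sq_nonneg _)) (by norm_num))
      (Finset.sum_nonneg fun i _ => mul_nonneg (h2 _ _) (sq_nonneg _))
  refine (dotProduct_self_le_energy h hl x hx).trans (mul_le_mul_of_nonneg_right ?_ hE0)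
  refine le_trans ?_ hμ
  rw [lambdaH, one_div_div, le_div_iff₀ (by norm_num)]
  have h1 : (1 : ℝ) ≤ N := by exact_mod_cast hN
  -- `N (N² - N + 4) - 4 (N² - N + 1) = (N - 1) (N - 2)²`.
  nlinarith [mul_nonneg (sub_nonneg.2 h1) (sq_nonneg ((N : ℝ) - 2))]

/-- The energy is a sum of nonnegative edge terms, so on the kernel every term vanishes. -/
theorem eq_of_leaderFollowerMatrix_mulVec_eq_zero (h : IsUndirected (followerSubgraph G))
    {x : Fin N → ℝ} (hx : leaderFollowerMatrix G *ᵥ x = 0) :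
    (∀ i j : Fin N, G.Adj j.succ i.succ → x i = x j) ∧ ∀ i : Fin N, G.Adj 0 i.succ → x i = 0 := by
  have hE := dotProduct_leaderFollowerMatrix_mulVec h x
  have h1 : ∀ i j, 0 ≤ adjacency (followerSubgraph G) i j * (x i - x j) ^ 2 := fun i j =>
    mul_nonneg (adjacency_nonneg _ _ _) (sq_nonneg _)
  have h2 : ∀ i : Fin N, 0 ≤ adjacency G i.succ 0 * x i ^ 2 := fun i =>
    mul_nonneg (adjacency_nonneg _ _ _) (sq_nonneg _)
  have h3 := Finset.sum_nonneg fun i (_ : i ∈ Finset.univ) =>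
    Finset.sum_nonneg fun j (_ : j ∈ Finset.univ) => h1 i j
  have h4 := Finset.sum_nonneg fun i (_ : i ∈ Finset.univ) => h2 i
  rw [hx, dotProduct_zero] at hE
  constructor
  · intro i j hij
    have h5 : ∑ i, ∑ j, adjacency (followerSubgraph G) i j * (x i - x j) ^ 2 = 0 := by linarith
    have h6 := (Finset.sum_eq_zero_iff_of_nonneg
      fun i _ => Finset.sum_nonneg fun j _ => h1 i j).1 h5 i (Finset.mem_univ _)
    have h7 := (Finset.sum_eq_zero_iff_of_nonneg fun j _ => h1 i j).1 h6 j (Finset.mem_univ _)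
    have h8 : adjacency (followerSubgraph G) i j = 1 := by
      simp [adjacency, followerSubgraph, hij]
    rw [h8, one_mul] at h7
    exact sub_eq_zero.1 (pow_eq_zero_iff (two_ne_zero)|>.1 h7)
  · intro i hi
    have h5 : ∑ i : Fin N, adjacency G i.succ 0 * x i ^ 2 = 0 := by linarith
    have h7 := (Finset.sum_eq_zero_iff_of_nonneg fun i _ => h2 i).1 h5 i (Finset.mem_univ _)
    have h8 : adjacency G i.succ 0 = 1 := by simp [adjacency, hi]
    rw [h8, one_mul] at h7
    exact pow_eq_zero_iff (two_ne_zero)|>.1 h7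

/-- A vector in the kernels of all leader-follower matrices of a family of graphs vanishes if all
followers are reachable from the leader in the union of the graphs. -/
theorem eq_zero_of_forall_mulVec_eq_zero {ι : Type*} {Γ : ι → Digraph (Fin (N + 1))}
    (h : ∀ p, IsUndirected (followerSubgraph (Γ p)))
    (hr : ∀ i : Fin N, Reachable (⨆ p, Γ p) 0 i.succ) {x : Fin N → ℝ}
    (hx : ∀ p, leaderFollowerMatrix (Γ p) *ᵥ x = 0) : x = 0 := by
  have key : ∀ k, Reachable (⨆ p, Γ p) 0 k → (Fin.cons 0 x : Fin (N + 1) → ℝ) k = 0 := by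
    -- Each edge of the union belongs to some graph of the family and passes the value zero on; an
    -- edge into the leader is harmless, since the value there is `0` by definition.
    have step : ∀ a b, (⨆ p, Γ p).Adj a b → (Fin.cons 0 x : Fin (N + 1) → ℝ) a = 0 →
        (Fin.cons 0 x : Fin (N + 1) → ℝ) b = 0 := by
      intro a b hab ha
      rw [Digraph.iSup_adj] at hab
      obtain ⟨p, hp⟩ := hab
      have h1 := eq_of_leaderFollowerMatrix_mulVec_eq_zero (h p) (hx p)
      rcases Fin.eq_zero_or_eq_succ b with rfl | ⟨j, rfl⟩
      · simp
      rcases Fin.eq_zero_or_eq_succ a with rfl | ⟨i, rfl⟩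
      · simpa using h1.2 j hp
      · rw [Fin.cons_succ] at ha ⊢
        rw [h1.1 j i hp, ha]
    intro k hk
    induction hk with
    | single hab => exact step _ _ hab (by simp)
    | tail _ hab ih => exact step _ _ hab ih
  ext i
  simpa using key i.succ (hr i)

end LeaderFollowerGraphs

/-! ### Switching instants, products of projections and the existence of `δ` -/

section KernelProjections

theorem SwitchingSignal.t_strictMono {P : Type*} (S : SwitchingSignal P) : StrictMono S.t :=
  strictMono_nat_of_lt_succ fun j => by linarith [S.dwell j, S.τ_pos]

theorem SwitchingSignal.t_nonneg {P : Type*} (S : SwitchingSignal P) (j : ℕ) : 0 ≤ S.t j := by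
  rw [← S.t_zero]; exact S.t_strictMono.monotone (Nat.zero_le j)

theorem SwitchingSignal.mul_le_t_sub {P : Type*} (S : SwitchingSignal P) (a l : ℕ) :
    l * S.τ ≤ S.t (a + l) - S.t a := by
  induction l with
  | zero => simp
  | succ l ih =>
    have := S.dwell (a + l)
    rw [← add_assoc]
    push_cast
    linarith

section OrderedProd

variable {M : Type*} [Monoid M]

theorem orderedProd_congr {F F' : ℕ → M} {a a' l : ℕ}
    (h : ∀ r < l, F (a + r) = F' (a' + r)) : orderedProd F a l = orderedProd F' a' l := by
  induction l with
  | zero => rfl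
  | succ l ih =>
    simp only [orderedProd]
    rw [h l (Nat.lt_succ_self l), ih fun r hr => h r (hr.trans (Nat.lt_succ_self l))]

theorem orderedProd_add (F : ℕ → M) (a l l' : ℕ) :
    orderedProd F a (l + l') = orderedProd F (a + l) l' * orderedProd F a l := by
  induction l' with
  | zero => simp [orderedProd]
  | succ l' ih => rw [← add_assoc, orderedProd, ih, orderedProd, mul_assoc, add_assoc]

theorem map_orderedProd {M' T : Type*} [Monoid M'] [FunLike T M M'] [MonoidHomClass T M M']
    (φ : T) (F : ℕ → M) (a l : ℕ) :
    φ (orderedProd F a l) = orderedProd (fun r => φ (F r)) a l := by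
  induction l with
  | zero => simp [orderedProd]
  | succ l ih => simp [orderedProd, ih]

end OrderedProd

section Projections

variable {E : Type*} [NormedAddCommGroup E] [InnerProductSpace ℝ E]

theorem norm_orderedProd_starProjection_apply_le (U : ℕ → Submodule ℝ E)
    [∀ r, (U r).HasOrthogonalProjection] (a l : ℕ) (x : E) :
    ‖orderedProd (fun r => (U r).starProjection) a l x‖ ≤ ‖x‖ := by
  induction l with
  | zero => simp [orderedProd]
  | succ l ih =>
    rw [orderedProd, mul_apply_eq_comp]
    exact ((U (a + l)).norm_starProjection_apply_le _).trans ih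

/-- If the norm survives the whole product, it survives every factor. Inductively the earlier
factors fix `x`, so the next one acts on `x` itself, and a projection preserves the norm only on its
range. -/
theorem mem_of_norm_orderedProd_starProjection_apply_eq (U : ℕ → Submodule ℝ E)
    [∀ r, (U r).HasOrthogonalProjection] {a l : ℕ} {x : E}
    (h : ‖orderedProd (fun r => (U r).starProjection) a l x‖ = ‖x‖) :
    orderedProd (fun r => (U r).starProjection) a l x = x ∧ ∀ r < l, x ∈ U (a + r) := by
  induction l with
  | zero => simp [orderedProd]
  | succ l ih =>
    rw [orderedProd, mul_apply_eq_comp] at h ⊢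
    have h1 := norm_orderedProd_starProjection_apply_le U a l x
    have h2 := (U (a + l)).norm_starProjection_apply_le
      (orderedProd (fun r => (U r).starProjection) a l x)
    obtain ⟨h3, h4⟩ := ih (le_antisymm h1 (h ▸ h2))
    rw [h3] at h ⊢
    have h5 : x ∈ U (a + l) := (Submodule.mem_iff_norm_starProjection _ _).2 h
    refine ⟨Submodule.starProjection_eq_self_iff.2 h5, fun r hr => ?_⟩
    rcases Nat.lt_succ_iff_lt_or_eq.1 hr with hr | rfl
    · exact h4 r hr
    · exact h5

theorem opNorm_lt_one_of_forall_norm_lt [FiniteDimensional ℝ E] (T : E →L[ℝ] E)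
    (h : ∀ x, x ≠ 0 → ‖T x‖ < ‖x‖) : ‖T‖ < 1 := by
  rcases subsingleton_or_nontrivial E with hE | hE
  · have : T = 0 := by ext x; exact Subsingleton.elim _ _
    simp [this]
  · obtain ⟨x, hx, hmax⟩ := (isCompact_sphere (0 : E) 1).exists_isMaxOn
      (NormedSpace.sphere_nonempty.2 zero_le_one) (T.continuous.norm.continuousOn)
    have hx1 : ‖x‖ = 1 := by simpa using hx
    have hx0 : x ≠ 0 := by rintro rfl; simp at hx1
    refine lt_of_le_of_lt ?_ ((h x hx0).trans_eq hx1)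
    exact ContinuousLinearMap.opNorm_le_of_unit_norm (norm_nonneg _) fun y hy =>
      hmax (by simpa using hy)

end Projections

variable {N : ℕ}

theorem mem_ker_toEuclideanLin {H : Matrix (Fin N) (Fin N) ℝ} {x : EuclideanSpace ℝ (Fin N)} :
    x ∈ LinearMap.ker (Matrix.toEuclideanLin H) ↔ H *ᵥ x.ofLp = 0 := by
  rw [LinearMap.mem_ker, Matrix.toLpLin_apply]
  exact WithLp.toLp_eq_zero 2

theorem norm_orderedProd_kerProj_lt_one {P : Type*} {S : SwitchingSignal P}
    {G : P → Digraph (Fin (N + 1))} {jk : ℕ → ℕ} {Tc : ℝ}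
    (hundir : ∀ j, IsUndirected (followerSubgraph (G (S.σ (S.t j)))))
    (hconn : JointlyConnected S G jk Tc) (k : ℕ) :
    ‖orderedProd (fun r => kerProj (leaderFollowerMatrix (G (S.σ (S.t r)))))
      (jk k) (jk (k + 1) - jk k)‖ < 1 := by
  refine opNorm_lt_one_of_forall_norm_lt _ fun x hx => ?_
  refine lt_of_le_of_ne (norm_orderedProd_starProjection_apply_le _ _ _ _) fun heq => hx ?_
  have h1 := (mem_of_norm_orderedProd_starProjection_apply_eq _ heq).2
  have h2 := eq_zero_of_forall_mulVec_eq_zero (x := x.ofLp)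
    (fun p : {j : ℕ // S.t j ∈ Set.Ico (S.t (jk k)) (S.t (jk (k + 1)))} => hundir p.1)
    (hconn.reachable k) ?_
  · exact (WithLp.ofLp_eq_zero 2).1 h2
  · rintro ⟨j, hj1, hj2⟩
    have hj1 := S.t_strictMono.le_iff_le.1 hj1
    have hj2 := S.t_strictMono.lt_iff_lt.1 hj2
    have h3 := mem_ker_toEuclideanLin.1 (h1 (j - jk k) (by omega))
    rwa [Nat.add_sub_cancel' hj1] at h3

/-- Norms below `1` for each window become a uniform bound by finiteness: the dwell time limits the
number of factors to about `Tc / τ`, and there are `n₀` choices for each. -/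
theorem exists_projectionProductsBounded {n₀ : ℕ} {S : SwitchingSignal (Fin n₀)}
    {G : Fin n₀ → Digraph (Fin (N + 1))} {jk : ℕ → ℕ} {Tc : ℝ}
    (hundir : ∀ j, IsUndirected (followerSubgraph (G (S.σ (S.t j)))))
    (hconn : JointlyConnected S G jk Tc) :
    ∃ δ : ℝ, 0 < δ ∧ δ < 1 ∧ ProjectionProductsBounded S G jk δ := by
  obtain ⟨L, hL⟩ := exists_nat_ge (Tc / S.τ)
  have hlen : ∀ k, jk (k + 1) - jk k ≤ L := fun k => by
    have h1 := S.mul_le_t_sub (jk k) (jk (k + 1) - jk k)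
    rw [Nat.add_sub_cancel' (hconn.strictMono (Nat.lt_succ_self k)).le] at h1
    have h2 := (le_div_iff₀ S.τ_pos).2 (h1.trans (hconn.window k))
    exact_mod_cast h2.trans hL
  set φ : ℕ → ℝ := fun k => ‖orderedProd
    (fun r => kerProj (leaderFollowerMatrix (G (S.σ (S.t r))))) (jk k) (jk (k + 1) - jk k)‖ with hφ
  have hfin : (Set.range φ).Finite := by
    -- A window is encoded by its length and a word of `L + 1` letters; `Fin.ofNat` reduces modulo
    -- `L + 1`, which changes nothing for the indices used.
    let ψ : Fin (L + 1) × (Fin (L + 1) → Fin n₀) → ℝ := fun w => ‖orderedProd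
      (fun r => kerProj (leaderFollowerMatrix (G (w.2 (Fin.ofNat (L + 1) r))))) 0 w.1‖
    refine (Set.finite_range ψ).subset ?_
    rintro _ ⟨k, rfl⟩
    refine ⟨⟨⟨jk (k + 1) - jk k, Nat.lt_succ_of_le (hlen k)⟩,
      fun r => S.σ (S.t (jk k + r))⟩, ?_⟩
    simp only [ψ, hφ]
    congr 1
    refine orderedProd_congr fun r hr => ?_
    have : r % (L + 1) = r := Nat.mod_eq_of_lt (by have := hlen k; omega)
    simp [this]
  obtain ⟨_, ⟨k₀, rfl⟩, hk₀⟩ := Set.exists_max_image (Set.range φ) id hfin ⟨_, ⟨0, rfl⟩⟩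
  -- The maximum with `1 / 2` secures `δ > 0`, since the products may all be zero.
  refine ⟨max (φ k₀) (1 / 2), lt_max_of_lt_right (by norm_num),
    max_lt (norm_orderedProd_kerProj_lt_one hundir hconn k₀) (by norm_num), fun k => ?_⟩
  exact (hk₀ _ ⟨k, rfl⟩).trans (le_max_left _ _)

/-- The matrix of the orthogonal projection onto the kernel of `H`. -/
def kerProjMatrix (H : Matrix (Fin N) (Fin N) ℝ) : Matrix (Fin N) (Fin N) ℝ :=
  (Matrix.toEuclideanCLM (n := Fin N) (𝕜 := ℝ)).symm (kerProj H)

theorem toEuclideanCLM_kerProjMatrix (H : Matrix (Fin N) (Fin N) ℝ) :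
    Matrix.toEuclideanCLM (n := Fin N) (𝕜 := ℝ) (kerProjMatrix H) = kerProj H :=
  StarAlgEquiv.apply_symm_apply _ _

theorem kerProjMatrix_mulVec (H : Matrix (Fin N) (Fin N) ℝ) (v : Fin N → ℝ) :
    kerProjMatrix H *ᵥ v = (kerProj H (WithLp.toLp 2 v)).ofLp := by
  rw [← toEuclideanCLM_kerProjMatrix, Matrix.toEuclideanCLM_toLp]

theorem mul_kerProjMatrix (H : Matrix (Fin N) (Fin N) ℝ) : H * kerProjMatrix H = 0 := by
  refine Matrix.ext_of_mulVec_single fun i => ?_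
  rw [← Matrix.mulVec_mulVec, kerProjMatrix_mulVec, Matrix.zero_mulVec]
  exact mem_ker_toEuclideanLin.1 (Submodule.starProjection_apply_mem _ _)

theorem kerProjMatrix_mulVec_of_mem {H : Matrix (Fin N) (Fin N) ℝ} {v : Fin N → ℝ}
    (hv : H *ᵥ v = 0) : kerProjMatrix H *ᵥ v = v := by
  rw [kerProjMatrix_mulVec]
  exact congrArg _ (Submodule.starProjection_eq_self_iff.2 (mem_ker_toEuclideanLin.2 hv))

theorem transpose_kerProjMatrix (H : Matrix (Fin N) (Fin N) ℝ) :
    (kerProjMatrix H)ᵀ = kerProjMatrix H := by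
  have h : star (kerProj H) = kerProj H :=
    (isSelfAdjoint_starProjection (LinearMap.ker (Matrix.toEuclideanLin H))).star_eq
  have h2 : star (kerProjMatrix H) = kerProjMatrix H :=
    ((Matrix.toEuclideanCLM (n := Fin N) (𝕜 := ℝ)).symm.map_star' (kerProj H)).symm.trans
      (congrArg _ h)
  rwa [Matrix.star_eq_conjTranspose, Matrix.conjTranspose_eq_transpose_of_trivial] at h2

theorem kerProjMatrix_mul {H : Matrix (Fin N) (Fin N) ℝ} (hH : Hᵀ = H) :
    kerProjMatrix H * H = 0 := by
  have := congrArg transpose (mul_kerProjMatrix H)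
  rwa [transpose_mul, hH, transpose_kerProjMatrix, transpose_zero] at this

theorem vecMul_one_sub_kerProjMatrix {H : Matrix (Fin N) (Fin N) ℝ} {v : Fin N → ℝ}
    (hv : H *ᵥ v = 0) : v ᵥ* (1 - kerProjMatrix H) = 0 := by
  rw [Matrix.vecMul_sub, Matrix.vecMul_one, ← transpose_kerProjMatrix, Matrix.vecMul_transpose,
    kerProjMatrix_mulVec_of_mem hv, sub_self]

open scoped Matrix.Norms.Frobenius

theorem frobenius_norm_sq {m n : ℕ} (Z : Matrix (Fin m) (Fin n) ℝ) :
    ‖Z‖ ^ 2 = ∑ i, ∑ j, Z i j ^ 2 := by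
  rw [frobenius_norm_def, ← Real.sqrt_eq_rpow, Real.sq_sqrt
    (Finset.sum_nonneg fun i _ => Finset.sum_nonneg fun j _ => by positivity)]
  simp

/-- Apply the operator bound to each column of `Z`. The Frobenius norm of `M` would be too large:
both the bound `δ` and the bound `1` for projections are operator norms. -/
theorem frobenius_norm_mul_le_opNorm {n : ℕ} (M : Matrix (Fin N) (Fin N) ℝ)
    (Z : Matrix (Fin N) (Fin n) ℝ) :
    ‖M * Z‖ ≤ ‖Matrix.toEuclideanCLM (n := Fin N) (𝕜 := ℝ) M‖ * ‖Z‖ := by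
  refine le_of_sq_le_sq ?_ (by positivity)
  rw [mul_pow, frobenius_norm_sq, frobenius_norm_sq, Finset.sum_comm, Finset.sum_comm (γ := Fin N),
    Finset.mul_sum]
  refine Finset.sum_le_sum fun j _ => ?_
  have h := (Matrix.toEuclideanCLM (n := Fin N) (𝕜 := ℝ) M).le_opNorm
    (WithLp.toLp 2 fun i => Z i j)
  have h2 := pow_le_pow_left₀ (norm_nonneg _) h 2
  rw [mul_pow, Matrix.toEuclideanCLM_toLp, EuclideanSpace.norm_sq_eq, EuclideanSpace.norm_sq_eq] at h2
  simpa [Matrix.mul_apply, Matrix.mulVec, dotProduct] using h2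

theorem norm_kerProjMatrix_mul_le {n : ℕ} (H : Matrix (Fin N) (Fin N) ℝ)
    (Z : Matrix (Fin N) (Fin n) ℝ) : ‖kerProjMatrix H * Z‖ ≤ ‖Z‖ := by
  refine (frobenius_norm_mul_le_opNorm _ _).trans (mul_le_of_le_one_left (norm_nonneg _) ?_)
  rw [toEuclideanCLM_kerProjMatrix]
  exact Submodule.starProjection_norm_le _

theorem norm_one_sub_kerProjMatrix_mul_le {n : ℕ} (H : Matrix (Fin N) (Fin N) ℝ)
    (Z : Matrix (Fin N) (Fin n) ℝ) : ‖(1 - kerProjMatrix H) * Z‖ ≤ ‖Z‖ := by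
  refine (frobenius_norm_mul_le_opNorm _ _).trans (mul_le_of_le_one_left (norm_nonneg _) ?_)
  rw [map_sub, map_one, toEuclideanCLM_kerProjMatrix]
  have h : (1 : EuclideanSpace ℝ (Fin N) →L[ℝ] EuclideanSpace ℝ (Fin N)) - kerProj H =
      (LinearMap.ker (Matrix.toEuclideanLin H))ᗮ.starProjection := by
    rw [Submodule.starProjection_orthogonal]; rfl
  rw [h]
  exact Submodule.starProjection_norm_le _

end KernelProjections

/-! ### Growth of the matrix exponential -/

section ExponentialGrowth

open scoped Matrix.Norms.Frobenius

/-- Split off the scalar part, `exp (tA) = exp (tz) exp (t (A - z))`; on a generalized eigenvector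
the second series stops. -/
theorem exp_smul_mulVec_eq_sum {n : ℕ} (A : Matrix (Fin n) (Fin n) ℂ) (z : ℂ) {k : ℕ}
    {v : Fin n → ℂ} (hv : (A - z • (1 : Matrix (Fin n) (Fin n) ℂ)) ^ k *ᵥ v = 0) (t : ℝ) :
    NormedSpace.exp (t • A) *ᵥ v = Complex.exp (t * z) • ∑ i ∈ Finset.range k,
      ((i.factorial : ℂ)⁻¹ * (t : ℂ) ^ i) •
        ((A - z • (1 : Matrix (Fin n) (Fin n) ℂ)) ^ i *ᵥ v) := by
  set M := A - z • (1 : Matrix (Fin n) (Fin n) ℂ) with hM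
  have h1 : t • A = ((t : ℂ) * z) • (1 : Matrix (Fin n) (Fin n) ℂ) + (t : ℂ) • M := by
    rw [hM, smul_sub, smul_smul, add_sub_cancel]
    ext i j
    simp
  have h2 : NormedSpace.exp (((t : ℂ) * z) • (1 : Matrix (Fin n) (Fin n) ℂ)) =
      Complex.exp (t * z) • (1 : Matrix (Fin n) (Fin n) ℂ) := by
    have := NormedSpace.algebraMap_exp_comm (𝕂 := ℂ) (𝔸 := Matrix (Fin n) (Fin n) ℂ) ((t : ℂ) * z)
    rw [Algebra.algebraMap_eq_smul_one, Algebra.algebraMap_eq_smul_one] at this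
    rw [Complex.exp_eq_exp_ℂ]
    exact this.symm
  rw [h1, Matrix.exp_add_of_commute _ _ (((Commute.one_left _).smul_left _).smul_right _), h2, smul_mul_assoc,
    one_mul, Matrix.smul_mulVec]
  congr 1
  have h3 := NormedSpace.exp_series_hasSum_exp' (𝕂 := ℂ) ((t : ℂ) • M)
  have h4 : HasSum (fun i : ℕ => ((i.factorial : ℂ)⁻¹ • ((t : ℂ) • M) ^ i) *ᵥ v)
      (NormedSpace.exp ((t : ℂ) • M) *ᵥ v) :=
    h3.map (AddMonoidHom.mk' (fun X : Matrix (Fin n) (Fin n) ℂ => X *ᵥ v)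
      fun X Y => Matrix.add_mulVec X Y v) (by
        change Continuous fun X : Matrix (Fin n) (Fin n) ℂ => X *ᵥ v
        fun_prop)
  refine h4.unique ?_
  have h5 : (fun i : ℕ => ((i.factorial : ℂ)⁻¹ • ((t : ℂ) • M) ^ i) *ᵥ v) = fun i : ℕ =>
      ((i.factorial : ℂ)⁻¹ * (t : ℂ) ^ i) • (M ^ i *ᵥ v) := by
    funext i
    rw [smul_pow, smul_smul, Matrix.smul_mulVec]
  rw [h5]
  refine hasSum_sum_of_ne_finset_zero fun i hi => ?_
  obtain ⟨r, rfl⟩ := Nat.exists_eq_add_of_le (not_lt.1 (mt Finset.mem_range.2 hi))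
  have h6 : M ^ (k + r) *ᵥ v = 0 := by
    rw [add_comm k r, pow_add, ← Matrix.mulVec_mulVec, hv, Matrix.mulVec_zero]
  rw [h6, smul_zero]

theorem exists_norm_exp_smul_mulVec_le_of_pow_mulVec_eq_zero {n : ℕ}
    (A : Matrix (Fin n) (Fin n) ℂ) {z : ℂ} {ρ : ℝ} (hz : z.re < ρ) {k : ℕ} {v : Fin n → ℂ}
    (hv : (A - z • (1 : Matrix (Fin n) (Fin n) ℂ)) ^ k *ᵥ v = 0) :
    ∃ C, ∀ t : ℝ, 0 ≤ t → ‖NormedSpace.exp (t • A) *ᵥ v‖ ≤ C * Real.exp (ρ * t) := by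
  set M := A - z • (1 : Matrix (Fin n) (Fin n) ℂ) with hM
  set ε := ρ - z.re with hε
  have hε0 : 0 < ε := sub_pos.2 hz
  -- The spare rate `ε` absorbs the polynomial factor: `t ^ i / i! ≤ ε ^ (-i) exp (ε t)`.
  refine ⟨∑ i ∈ Finset.range k, (ε ^ i)⁻¹ * ‖M ^ i *ᵥ v‖, fun t ht => ?_⟩
  rw [exp_smul_mulVec_eq_sum A z hv t, norm_smul, Complex.norm_exp]
  have h1 : ((t : ℂ) * z).re = t * z.re := by simp
  have h2 : Real.exp (ρ * t) = Real.exp (t * z.re) * Real.exp (ε * t) := by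
    rw [← Real.exp_add]; congr 1; rw [hε]; ring
  rw [h1, h2, mul_left_comm]
  refine mul_le_mul_of_nonneg_left ?_ (Real.exp_nonneg _)
  rw [Finset.sum_mul]
  refine (norm_sum_le _ _).trans (Finset.sum_le_sum fun i _ => ?_)
  rw [norm_smul, mul_right_comm]
  refine mul_le_mul_of_nonneg_right ?_ (norm_nonneg _)
  have h3 := Real.pow_div_factorial_le_exp (ε * t) (by positivity) i
  have h4 : ‖(i.factorial : ℂ)⁻¹ * (t : ℂ) ^ i‖ = (i.factorial : ℝ)⁻¹ * t ^ i := by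
    rw [norm_mul, norm_inv, norm_pow, Complex.norm_natCast, Complex.norm_real,
      Real.norm_of_nonneg ht]
  rw [h4, ← div_eq_inv_mul (Real.exp _), le_div_iff₀ (by positivity)]
  refine le_trans (le_of_eq ?_) h3
  rw [mul_pow]; ring

/-- Over `ℂ` the generalized eigenspaces span, so it suffices to treat generalized eigenvectors and
sums. -/
theorem exists_norm_exp_smul_mulVec_le {n : ℕ} (A : Matrix (Fin n) (Fin n) ℂ) {ρ : ℝ}
    (hρ : ∀ z ∈ spectrum ℂ A, z.re < ρ) (v : Fin n → ℂ) :
    ∃ C, ∀ t : ℝ, 0 ≤ t → ‖NormedSpace.exp (t • A) *ᵥ v‖ ≤ C * Real.exp (ρ * t) := by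
  have hv : v ∈ ⨆ z : ℂ, Module.End.maxGenEigenspace (Matrix.toLin' A) z := by
    rw [Module.End.iSup_maxGenEigenspace_eq_top]; trivial
  induction hv using Submodule.iSup_induction' with
  | mem z x hx =>
    by_cases hx0 : x = 0
    · exact ⟨0, fun t _ => by simp [hx0]⟩
    have hz : z ∈ spectrum ℂ A := by
      rw [← Matrix.spectrum_toLin']
      have h1 : Module.End.HasUnifEigenvalue (Matrix.toLin' A) z ⊤ := by
        intro h
        exact hx0 (by simpa [Module.End.maxGenEigenspace, h] using hx)
      exact (Module.End.HasUnifEigenvalue.lt one_pos h1).mem_spectrum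
    obtain ⟨k, hk⟩ := (Module.End.mem_maxGenEigenspace _ _ _).1 hx
    refine exists_norm_exp_smul_mulVec_le_of_pow_mulVec_eq_zero A (hρ z hz) (k := k) ?_
    have h2 : Matrix.toLin' A - z • (1 : Module.End ℂ (Fin n → ℂ)) =
        Matrix.toLin' (A - z • (1 : Matrix (Fin n) (Fin n) ℂ)) := by
      rw [map_sub, map_smul, Matrix.toLin'_one]; rfl
    rw [h2, ← Matrix.toLin'_pow, Matrix.toLin'_apply] at hk
    exact hk
  | zero => exact ⟨0, fun t _ => by simp⟩
  | add x y _ _ hx hy =>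
    obtain ⟨C, hC⟩ := hx
    obtain ⟨D, hD⟩ := hy
    refine ⟨C + D, fun t ht => ?_⟩
    rw [Matrix.mulVec_add, add_mul]
    exact (norm_add_le _ _).trans (add_le_add (hC t ht) (hD t ht))

theorem map_ofReal_exp {n : ℕ} (A : Matrix (Fin n) (Fin n) ℝ) :
    (NormedSpace.exp A).map (fun a : ℝ => (a : ℂ)) =
      NormedSpace.exp (A.map (fun a : ℝ => (a : ℂ))) :=
  NormedSpace.map_exp (Complex.ofRealHom.mapMatrix (m := Fin n))
    (Continuous.matrix_map continuous_id Complex.continuous_ofReal) A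

/-- The exponential of `t A` grows at most as `exp (ρ t)` for every `ρ` above the spectral
abscissa of `A`. -/
theorem exists_norm_exp_smul_le {n : ℕ} (A : Matrix (Fin n) (Fin n) ℝ) {ρ : ℝ}
    (hρ : lambdaMax A < ρ) :
    ∃ C, 0 < C ∧ ∀ t : ℝ, 0 ≤ t → ‖NormedSpace.exp (t • A)‖ ≤ C * Real.exp (ρ * t) := by
  have hspec : ∀ z ∈ spectrum ℂ (A.map (fun a : ℝ => (a : ℂ))), z.re < ρ := fun z hz =>
    (le_csSup ((Matrix.finite_spectrum _).image _).bddAbove ⟨z, hz, rfl⟩).trans_lt hρ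
  choose C hC using fun j : Fin n => exists_norm_exp_smul_mulVec_le _ hspec (Pi.single j 1)
  have hC0 : ∀ j, 0 ≤ C j := fun j => by
    have := (norm_nonneg _).trans (hC j 0 le_rfl)
    simpa using this
  have hentry : ∀ t : ℝ, 0 ≤ t → ∀ i j,
      |NormedSpace.exp (t • A) i j| ≤ C j * Real.exp (ρ * t) := by
    intro t ht i j
    have h1 : t • A.map (fun a : ℝ => (a : ℂ)) = (t • A).map (fun a : ℝ => (a : ℂ)) := by
      ext i j; simp
    have h2 := (norm_le_pi_norm _ i).trans (hC j t ht)
    rwa [h1, ← map_ofReal_exp, Matrix.mulVec_single_one, Matrix.col_apply, Matrix.map_apply,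
      Complex.norm_real, Real.norm_eq_abs] at h2
  refine ⟨Real.sqrt (∑ _i : Fin n, ∑ j, C j ^ 2) + 1, by positivity, fun t ht => ?_⟩
  refine le_trans (b := Real.sqrt (∑ _i : Fin n, ∑ j, C j ^ 2) * Real.exp (ρ * t)) ?_
    (mul_le_mul_of_nonneg_right (by linarith) (Real.exp_nonneg _))
  refine le_of_sq_le_sq ?_ (by positivity)
  rw [frobenius_norm_sq, mul_pow, Real.sq_sqrt (Finset.sum_nonneg fun i _ =>
    Finset.sum_nonneg fun j _ => sq_nonneg _), Finset.sum_mul]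
  refine Finset.sum_le_sum fun i _ => ?_
  rw [Finset.sum_mul]
  refine Finset.sum_le_sum fun j _ => ?_
  rw [← mul_pow, ← sq_abs (NormedSpace.exp (t • A) i j)]
  exact pow_le_pow_left₀ (abs_nonneg _) (hentry t ht i j) 2

end ExponentialGrowth

/-! ### Entrywise derivatives of matrix functions -/

section MatrixCalculus

theorem hasDerivAt_exp_smul_apply {n : ℕ} (A : Matrix (Fin n) (Fin n) ℝ) (s : ℝ) (i j : Fin n) :
    HasDerivAt (fun r : ℝ => NormedSpace.exp (r • A) i j) ((A * NormedSpace.exp (s • A)) i j) s := by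
  open scoped Matrix.Norms.Frobenius in
  have h := hasDerivAt_exp_smul_const' (𝕂 := ℝ) A s
  exact (LinearMap.toContinuousLinearMap (Matrix.entryLinearMap ℝ ℝ i j)).hasFDerivAt.comp_hasDerivAt s h

theorem hasDerivWithinAt_mul_apply {l m n : ℕ} {X : ℝ → Matrix (Fin l) (Fin m) ℝ}
    {Y : ℝ → Matrix (Fin m) (Fin n) ℝ} {X' : Matrix (Fin l) (Fin m) ℝ}
    {Y' : Matrix (Fin m) (Fin n) ℝ} {u : Set ℝ} {s : ℝ}
    (hX : ∀ i j, HasDerivWithinAt (fun r => X r i j) (X' i j) u s)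
    (hY : ∀ i j, HasDerivWithinAt (fun r => Y r i j) (Y' i j) u s) (i : Fin l) (j : Fin n) :
    HasDerivWithinAt (fun r => (X r * Y r) i j) ((X' * Y s + X s * Y') i j) u s := by
  simp only [Matrix.mul_apply, Matrix.add_apply, ← Finset.sum_add_distrib]
  exact HasDerivWithinAt.fun_sum fun k _ => (hX i k).mul (hY k j)

end MatrixCalculus

/-! ### Bounds for quadratic forms and their inverses -/

section QuadraticForms

variable {n : ℕ}

theorem zero_le_dotProduct_self (x : Fin n → ℝ) : 0 ≤ x ⬝ᵥ x :=
  Finset.sum_nonneg fun i _ => mul_self_nonneg (x i)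

theorem dotProduct_mulVec_comm {M : Matrix (Fin n) (Fin n) ℝ} (hM : Mᵀ = M) (x y : Fin n → ℝ) :
    x ⬝ᵥ (M *ᵥ y) = y ⬝ᵥ (M *ᵥ x) := by
  rw [Matrix.dotProduct_mulVec, ← Matrix.mulVec_transpose, hM, dotProduct_comm]

theorem exists_dotProduct_mulVec_le (M : Matrix (Fin n) (Fin n) ℝ) :
    ∃ C, 0 < C ∧ ∀ x, x ⬝ᵥ (M *ᵥ x) ≤ C * (x ⬝ᵥ x) := by
  refine ⟨∑ i, ∑ j, |M i j| + 1, by positivity, fun x => ?_⟩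
  have h1 : x ⬝ᵥ (M *ᵥ x) = ∑ i, ∑ j, x i * (M i j * x j) := by
    simp only [dotProduct, mulVec, Finset.mul_sum]
  have h2 : ∀ i, x i ^ 2 ≤ x ⬝ᵥ x := fun i => by
    rw [sq]
    exact Finset.single_le_sum (f := fun i => x i * x i) (fun i _ => mul_self_nonneg (x i))
      (Finset.mem_univ i)
  rw [h1, add_mul, Finset.sum_mul]
  refine le_trans (Finset.sum_le_sum fun i _ => ?_)
    (le_add_of_nonneg_right (mul_nonneg zero_le_one (zero_le_dotProduct_self x)))
  rw [Finset.sum_mul]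
  refine Finset.sum_le_sum fun j _ => ?_
  have h3 : |x i * x j| ≤ x ⬝ᵥ x := by
    rw [abs_le]
    constructor <;> nlinarith [h2 i, h2 j, sq_nonneg (x i + x j), sq_nonneg (x i - x j)]
  calc x i * (M i j * x j) = M i j * (x i * x j) := by ring
    _ ≤ |M i j * (x i * x j)| := le_abs_self _
    _ = |M i j| * |x i * x j| := abs_mul _ _
    _ ≤ _ := by gcongr

/-- This is `M² ≤ C M`, obtained without square roots of matrices: expand the nonnegative form at `C
x - M x` and use the upper bound at `M x`. -/
theorem dotProduct_mulVec_self_le {M : Matrix (Fin n) (Fin n) ℝ} (hM : Mᵀ = M)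
    (hM0 : ∀ x, 0 ≤ x ⬝ᵥ (M *ᵥ x)) {C : ℝ} (hC : 0 < C)
    (h : ∀ x, x ⬝ᵥ (M *ᵥ x) ≤ C * (x ⬝ᵥ x)) (x : Fin n → ℝ) :
    (M *ᵥ x) ⬝ᵥ (M *ᵥ x) ≤ C * (x ⬝ᵥ (M *ᵥ x)) := by
  have h1 := hM0 (C • x - M *ᵥ x)
  have h2 := h (M *ᵥ x)
  have h3 : x ⬝ᵥ (M *ᵥ (M *ᵥ x)) = (M *ᵥ x) ⬝ᵥ (M *ᵥ x) := dotProduct_mulVec_comm hM _ _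
  rw [Matrix.mulVec_sub, Matrix.mulVec_smul, sub_dotProduct, dotProduct_sub, dotProduct_sub,
    smul_dotProduct, smul_dotProduct, dotProduct_smul, dotProduct_smul, h3] at h1
  simp only [smul_eq_mul] at h1
  have h4 : C * ((M *ᵥ x) ⬝ᵥ (M *ᵥ x)) ≤ C * (C * (x ⬝ᵥ (M *ᵥ x))) := by linarith
  exact le_of_mul_le_mul_left h4 hC

theorem _root_.Matrix.PosDef.transpose_eq {M : Matrix (Fin n) (Fin n) ℝ} (hM : M.PosDef) : Mᵀ = M := by
  have := hM.isHermitian.eq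
  rwa [Matrix.conjTranspose_eq_transpose_of_trivial] at this

theorem _root_.Matrix.PosDef.zero_le_dotProduct_mulVec {M : Matrix (Fin n) (Fin n) ℝ} (hM : M.PosDef)
    (x : Fin n → ℝ) : 0 ≤ x ⬝ᵥ (M *ᵥ x) := by
  simpa using hM.posSemidef.dotProduct_mulVec_nonneg x

theorem _root_.Matrix.PosDef.mulVec_inv_mulVec {M : Matrix (Fin n) (Fin n) ℝ} (hM : M.PosDef)
    (x : Fin n → ℝ) : M *ᵥ (M⁻¹ *ᵥ x) = x := by
  rw [Matrix.mulVec_mulVec, Matrix.mul_nonsing_inv _ ((Matrix.isUnit_iff_isUnit_det _).1 hM.isUnit),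
    Matrix.one_mulVec]

theorem dotProduct_self_le_mul_inv {M : Matrix (Fin n) (Fin n) ℝ} (hM : M.PosDef) {C : ℝ}
    (hC : 0 < C) (h : ∀ x, x ⬝ᵥ (M *ᵥ x) ≤ C * (x ⬝ᵥ x)) (x : Fin n → ℝ) :
    x ⬝ᵥ x ≤ C * (x ⬝ᵥ (M⁻¹ *ᵥ x)) := by
  have h1 := dotProduct_mulVec_self_le hM.transpose_eq hM.zero_le_dotProduct_mulVec hC h (M⁻¹ *ᵥ x)
  rwa [hM.mulVec_inv_mulVec, dotProduct_comm (M⁻¹ *ᵥ x)] at h1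

theorem exists_le_dotProduct_mulVec {M : Matrix (Fin n) (Fin n) ℝ} (hM : M.PosDef) :
    ∃ c, 0 < c ∧ ∀ x, c * (x ⬝ᵥ x) ≤ x ⬝ᵥ (M *ᵥ x) := by
  obtain ⟨C, hC, h⟩ := exists_dotProduct_mulVec_le M⁻¹
  refine ⟨C⁻¹, inv_pos.2 hC, fun x => ?_⟩
  have h1 := dotProduct_self_le_mul_inv hM.inv hC h x
  rw [Matrix.nonsing_inv_nonsing_inv _ ((Matrix.isUnit_iff_isUnit_det _).1 hM.isUnit)] at h1
  rw [inv_mul_le_iff₀ hC]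
  exact h1

theorem mul_dotProduct_inv_mulVec_le {M : Matrix (Fin n) (Fin n) ℝ} (hM : M.PosDef) {c : ℝ}
    (hc : 0 < c) (h : ∀ x, c * (x ⬝ᵥ x) ≤ x ⬝ᵥ (M *ᵥ x)) (x : Fin n → ℝ) :
    c * (x ⬝ᵥ (M⁻¹ *ᵥ x)) ≤ x ⬝ᵥ x := by
  set y := M⁻¹ *ᵥ x
  have h1 := h y
  rw [hM.mulVec_inv_mulVec] at h1
  -- Here `‖x‖² ≥ 2c x·y - c² ‖y‖²`, and the hypothesis at `y` gives `c ‖y‖² ≤ x·y`.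
  have h2 := zero_le_dotProduct_self (x - c • y)
  simp only [sub_dotProduct, dotProduct_sub, smul_dotProduct, dotProduct_smul, smul_eq_mul,
    dotProduct_comm y x] at h1 h2
  have h3 := mul_le_mul_of_nonneg_left h1 hc.le
  linarith

end QuadraticForms

/-! ### The weighted controllability Gramian -/

section Gramian

variable {n m : ℕ} (A : Matrix (Fin n) (Fin n) ℝ) (B : Matrix (Fin n) (Fin m) ℝ)

/-- The output `yᵀ exp (-(s / 2) A) B` of the adjoint system. -/
def adjointOutput (s : ℝ) (y : Fin n → ℝ) : Fin m → ℝ :=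
  y ᵥ* (NormedSpace.exp ((-(s / 2)) • A) * B)

theorem hasDerivAt_adjointOutput (y : Fin n → ℝ) (s : ℝ) :
    HasDerivAt (fun s => adjointOutput A B s y) ((-(1 / 2) : ℝ) • adjointOutput A B s (y ᵥ* A)) s := by
  rw [hasDerivAt_pi]
  intro j
  have h1 : ∀ i k, HasDerivAt (fun r : ℝ => NormedSpace.exp ((-(r / 2)) • A) i k)
      ((A * NormedSpace.exp ((-(s / 2)) • A)) i k * (-(1 / 2))) s := fun i k =>
    HasDerivAt.comp s (h₂ := fun r => NormedSpace.exp (r • A) i k) (h := fun r => -(r / 2))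
      (hasDerivAt_exp_smul_apply A (-(s / 2)) i k) ((hasDerivAt_id' s).div_const 2).fun_neg
  have h2 : HasDerivAt (fun r => ∑ i, y i * ∑ k, NormedSpace.exp ((-(r / 2)) • A) i k * B k j)
      (∑ i, y i * ∑ k, (A * NormedSpace.exp ((-(s / 2)) • A)) i k * (-(1 / 2)) * B k j) s :=
    HasDerivAt.fun_sum fun i _ => HasDerivAt.const_mul _
      (HasDerivAt.fun_sum fun k _ => (h1 i k).mul_const _)
  have h3 : ∀ r, adjointOutput A B r y j =
      ∑ i, y i * ∑ k, NormedSpace.exp ((-(r / 2)) • A) i k * B k j := fun r => by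
    simp only [adjointOutput, Matrix.vecMul, dotProduct, Matrix.mul_apply]
  simp only [h3]
  refine h2.congr_deriv ?_
  rw [adjointOutput, Matrix.vecMul_vecMul, ← Matrix.mul_assoc, Pi.smul_apply, smul_eq_mul]
  simp only [Matrix.vecMul, dotProduct, Matrix.mul_apply (N := B), Finset.mul_sum]
  refine Finset.sum_congr rfl fun i _ => Finset.sum_congr rfl fun k _ => ?_
  ring

theorem continuous_adjointOutput (y : Fin n → ℝ) : Continuous fun s => adjointOutput A B s y :=
  continuous_iff_continuousAt.2 fun s => (hasDerivAt_adjointOutput A B y s).continuousAt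

theorem continuous_gramian_integrand (α : ℝ) (y z : Fin n → ℝ) :
    Continuous fun s => Real.exp (-α * s) * (adjointOutput A B s y ⬝ᵥ adjointOutput A B s z) := by
  have h1 := continuous_adjointOutput A B y
  have h2 := continuous_adjointOutput A B z
  refine Continuous.mul (by fun_prop) ?_
  simp only [dotProduct]
  exact continuous_finsetSum _ fun i _ => ((continuous_apply i).comp h1).mul
    ((continuous_apply i).comp h2)

theorem gramian_apply (α T : ℝ) (i j : Fin n) :
    gramian A B α T i j = ∫ s in (0 : ℝ)..T, Real.exp (-α * s) *
      (adjointOutput A B s (Pi.single i 1) ⬝ᵥ adjointOutput A B s (Pi.single j 1)) := by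
  simp only [gramian, of_apply]
  congr 1
  funext s
  have h : NormedSpace.exp ((-(s / 2)) • Aᵀ) = (NormedSpace.exp ((-(s / 2)) • A))ᵀ := by
    rw [← Matrix.exp_transpose, Matrix.transpose_smul]
  rw [h, Matrix.smul_apply, smul_eq_mul, adjointOutput, adjointOutput, Matrix.single_one_vecMul,
    Matrix.single_one_vecMul, Matrix.mul_assoc, ← Matrix.transpose_mul, Matrix.mul_apply]
  rfl

theorem adjointOutput_eq_sum (s : ℝ) (y : Fin n → ℝ) :
    adjointOutput A B s y = ∑ i, y i • adjointOutput A B s (Pi.single i 1) := by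
  simp only [adjointOutput, Matrix.single_one_vecMul]
  exact Matrix.vecMul_eq_sum _ _

theorem dotProduct_gramian_mulVec (α T : ℝ) (y z : Fin n → ℝ) :
    y ⬝ᵥ (gramian A B α T *ᵥ z) = ∫ s in (0 : ℝ)..T, Real.exp (-α * s) *
      (adjointOutput A B s y ⬝ᵥ adjointOutput A B s z) := by
  have h1 : ∀ s, Real.exp (-α * s) * (adjointOutput A B s y ⬝ᵥ adjointOutput A B s z) =
      ∑ i, ∑ j, y i * z j * (Real.exp (-α * s) * (adjointOutput A B s (Pi.single i 1) ⬝ᵥ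
        adjointOutput A B s (Pi.single j 1))) := by
    intro s
    rw [adjointOutput_eq_sum A B s y, adjointOutput_eq_sum A B s z, sum_dotProduct, Finset.mul_sum]
    refine Finset.sum_congr rfl fun i _ => ?_
    rw [dotProduct_sum, Finset.mul_sum]
    refine Finset.sum_congr rfl fun j _ => ?_
    rw [smul_dotProduct, dotProduct_smul, smul_eq_mul, smul_eq_mul]
    ring
  have hc : ∀ i j, Continuous fun s => y i * z j * (Real.exp (-α * s) *
      (adjointOutput A B s (Pi.single i 1) ⬝ᵥ adjointOutput A B s (Pi.single j 1))) := fun i j =>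
    continuous_const.mul (continuous_gramian_integrand A B α _ _)
  have h2 : y ⬝ᵥ (gramian A B α T *ᵥ z) = ∑ i, ∑ j, y i * z j * gramian A B α T i j := by
    simp only [dotProduct, mulVec, Finset.mul_sum]
    refine Finset.sum_congr rfl fun i _ => Finset.sum_congr rfl fun j _ => ?_
    ring
  simp only [h1, h2]
  rw [intervalIntegral.integral_finsetSum fun i _ =>
    (continuous_finsetSum _ fun j _ => hc i j).intervalIntegrable _ _]
  refine Finset.sum_congr rfl fun i _ => ?_
  rw [intervalIntegral.integral_finsetSum fun j _ => (hc i j).intervalIntegrable _ _]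
  refine Finset.sum_congr rfl fun j _ => ?_
  rw [intervalIntegral.integral_const_mul, gramian_apply]

theorem gramian_transpose (α T : ℝ) : (gramian A B α T)ᵀ = gramian A B α T := by
  ext i j
  rw [transpose_apply, gramian_apply, gramian_apply]
  simp only [dotProduct_comm]

variable {A B}

theorem eq_zero_of_controllable (h : Controllable A B) {y : Fin n → ℝ}
    (hy : ∀ k : ℕ, (y ᵥ* A ^ k) ᵥ* B = 0) : y = 0 := by
  set M := Matrix.of fun (i : Fin n) (p : Fin n × Fin m) => (A ^ (p.1 : ℕ) * B) i p.2 with hM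
  have h1 : LinearIndependent ℝ M.row := by
    rw [linearIndependent_iff_card_eq_finrank_span, Set.finrank, ← Matrix.rank_eq_finrank_span_row,
      Fintype.card_fin]
    exact h.symm
  have h2 := Matrix.vecMul_injective_iff.2 h1
  refine h2 ?_
  change y ᵥ* M = 0 ᵥ* M
  rw [Matrix.zero_vecMul]
  ext p
  have h3 := congrFun (hy p.1) p.2
  rw [Matrix.vecMul_vecMul] at h3
  exact h3

/-- An output vanishing on an interval has vanishing derivative there, which is a nonzero multiple
of the output of `y A`. Iterating and evaluating at time `0` gives `y A^k B = 0` for all `k`. -/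
theorem exists_adjointOutput_ne_zero (h : Controllable A B) {T : ℝ} (hT : 0 < T) {y : Fin n → ℝ}
    (hy : y ≠ 0) : ∃ s ∈ Set.Icc 0 T, adjointOutput A B s y ≠ 0 := by
  by_contra! hcon
  refine hy (eq_zero_of_controllable h fun k => ?_)
  have h1 : ∀ k : ℕ, ∀ s ∈ Set.Icc 0 T, adjointOutput A B s (y ᵥ* A ^ k) = 0 := by
    intro k
    induction k with
    | zero => simpa using hcon
    | succ k ih =>
      intro s hs
      have h2 := (hasDerivAt_adjointOutput A B (y ᵥ* A ^ k) s).hasDerivWithinAt (s := Set.Icc 0 T)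
      have h3 : HasDerivWithinAt (fun s => adjointOutput A B s (y ᵥ* A ^ k)) 0 (Set.Icc 0 T) s :=
        (hasDerivWithinAt_const s (Set.Icc 0 T) (0 : Fin m → ℝ)).congr ih (ih s hs)
      have h4 := ((uniqueDiffOn_Icc hT) s hs).eq_deriv _ h2 h3
      rw [pow_succ, ← Matrix.vecMul_vecMul]
      exact (smul_eq_zero.1 h4).resolve_left (by norm_num)
  have h2 := h1 k 0 ⟨le_rfl, hT.le⟩
  simpa [adjointOutput, ← Matrix.vecMul_vecMul] using h2

theorem gramian_posDef (h : Controllable A B) (α : ℝ) {T : ℝ} (hT : 0 < T) :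
    (gramian A B α T).PosDef := by
  refine Matrix.PosDef.of_dotProduct_mulVec_pos ?_ fun y hy => ?_
  · rw [Matrix.IsHermitian, Matrix.conjTranspose_eq_transpose_of_trivial, gramian_transpose]
  · rw [star_trivial, dotProduct_gramian_mulVec]
    obtain ⟨s, hs, hne⟩ := exists_adjointOutput_ne_zero h hT hy
    refine intervalIntegral.integral_pos hT
      (continuous_gramian_integrand A B α y y).continuousOn (fun s _ =>
      mul_nonneg (Real.exp_nonneg _) (zero_le_dotProduct_self _)) ⟨s, hs, ?_⟩
    refine mul_pos (Real.exp_pos _) ((zero_le_dotProduct_self _).lt_of_ne' ?_)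
    rwa [Ne, dotProduct_self_eq_zero]

/-- Truncate the integral at `ε`, where the weight is still at least `exp (-α ε)`. The free choice
of `ε` limits how fast the Gramian degenerates as `α` grows. -/
theorem gramian_lower_bound {α : ℝ} (hα : 0 ≤ α) {ε T : ℝ} (hε : 0 ≤ ε) (hT : ε ≤ T)
    (y : Fin n → ℝ) : Real.exp (-α * ε) * (y ⬝ᵥ (gramian A B 0 ε *ᵥ y)) ≤
      y ⬝ᵥ (gramian A B α T *ᵥ y) := by
  rw [dotProduct_gramian_mulVec, dotProduct_gramian_mulVec, ← intervalIntegral.integral_const_mul]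
  have hc := continuous_gramian_integrand A B α y y
  refine le_trans (intervalIntegral.integral_mono_on hε
    ((continuous_const.mul (continuous_gramian_integrand A B 0 y y)).intervalIntegrable _ _)
    (hc.intervalIntegrable _ _) fun s hs => ?_)
    (intervalIntegral.integral_mono_interval le_rfl hε hT ?_ (hc.intervalIntegrable _ _))
  · rw [neg_zero, zero_mul, Real.exp_zero, one_mul]
    refine mul_le_mul_of_nonneg_right (Real.exp_le_exp.2 ?_) (zero_le_dotProduct_self _)
    nlinarith [hs.2]
  · exact Filter.Eventually.of_forall fun s =>
      mul_nonneg (Real.exp_nonneg _) (zero_le_dotProduct_self _)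

theorem gramian_upper_bound {α : ℝ} (hα : 0 ≤ α) {T : ℝ} (hT : 0 ≤ T)
    (y : Fin n → ℝ) : y ⬝ᵥ (gramian A B α T *ᵥ y) ≤ y ⬝ᵥ (gramian A B 0 T *ᵥ y) := by
  rw [dotProduct_gramian_mulVec, dotProduct_gramian_mulVec]
  refine intervalIntegral.integral_mono_on hT
    ((continuous_gramian_integrand A B α y y).intervalIntegrable _ _)
    ((continuous_gramian_integrand A B 0 y y).intervalIntegrable _ _) fun s hs => ?_
  refine mul_le_mul_of_nonneg_right (Real.exp_le_exp.2 ?_) (zero_le_dotProduct_self _)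
  nlinarith [hs.1]

/-- The Lyapunov inequality `α W + (A W + W Aᵀ) / 2 ≤ B Bᵀ` for `W = gramian A B α T`. -/
theorem gramian_lyapunov (α T : ℝ) (y : Fin n → ℝ) :
    α * (y ⬝ᵥ (gramian A B α T *ᵥ y)) + (y ᵥ* A) ⬝ᵥ (gramian A B α T *ᵥ y) ≤
      (y ᵥ* B) ⬝ᵥ (y ᵥ* B) := by
  -- Integrate the derivative of the Gramian integrand over `[0, T]` and discard the endpoint value
  -- `g T ≥ 0`.
  set g : ℝ → ℝ := fun s => Real.exp (-α * s) * (adjointOutput A B s y ⬝ᵥ adjointOutput A B s y)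
  set g' : ℝ → ℝ := fun s => -α * (Real.exp (-α * s) *
      (adjointOutput A B s y ⬝ᵥ adjointOutput A B s y)) -
      Real.exp (-α * s) * (adjointOutput A B s (y ᵥ* A) ⬝ᵥ adjointOutput A B s y)
  have hd : ∀ s, HasDerivAt g (g' s) s := by
    intro s
    have h1 : HasDerivAt (fun s => Real.exp (-α * s)) (Real.exp (-α * s) * (-α)) s := by
      simpa using ((hasDerivAt_id s).const_mul (-α)).exp
    have h2 := hasDerivAt_pi.1 (hasDerivAt_adjointOutput A B y s)
    have h3 : HasDerivAt (fun s => adjointOutput A B s y ⬝ᵥ adjointOutput A B s y)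
        (-(adjointOutput A B s (y ᵥ* A) ⬝ᵥ adjointOutput A B s y)) s := by
      simp only [dotProduct, ← Finset.sum_neg_distrib]
      refine HasDerivAt.fun_sum fun i _ => ?_
      refine ((h2 i).fun_mul (h2 i)).congr_deriv ?_
      simp only [Pi.smul_apply, smul_eq_mul]
      ring
    refine (h1.fun_mul h3).congr_deriv ?_
    simp only [g']
    ring
  have hc1 := continuous_gramian_integrand A B α y y
  have hc2 := continuous_gramian_integrand A B α (y ᵥ* A) y
  have hint : ∫ s in (0 : ℝ)..T, g' s = g T - g 0 :=
    intervalIntegral.integral_eq_sub_of_hasDerivAt (fun s _ => hd s)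
      (((continuous_const.mul hc1).sub hc2).intervalIntegrable _ _)
  have hsplit : ∫ s in (0 : ℝ)..T, g' s = -α * (y ⬝ᵥ (gramian A B α T *ᵥ y)) -
      (y ᵥ* A) ⬝ᵥ (gramian A B α T *ᵥ y) := by
    rw [dotProduct_gramian_mulVec, dotProduct_gramian_mulVec,
      ← intervalIntegral.integral_const_mul]
    exact intervalIntegral.integral_sub
      ((continuous_const.mul hc1).intervalIntegrable _ _) (hc2.intervalIntegrable _ _)
  have h0 : g 0 = (y ᵥ* B) ⬝ᵥ (y ᵥ* B) := by simp [g, adjointOutput]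
  have hT : 0 ≤ g T := mul_nonneg (Real.exp_nonneg _) (zero_le_dotProduct_self _)
  linarith

end Gramian

/-! ### The error equation on one switching interval -/

section ErrorDynamics

variable {N n m : ℕ}

/-- `Z` solves the error equation `Z' = Z Aᵀ - H Z Mᵀ` on `[a, b]` (rows of `Z` are the errors of
the followers). -/
structure SolvesErrorEquation (A M : Matrix (Fin n) (Fin n) ℝ) (H : Matrix (Fin N) (Fin N) ℝ)
    (Z : ℝ → Matrix (Fin N) (Fin n) ℝ) (a b : ℝ) : Prop where
  continuousOn : ∀ i j, ContinuousOn (fun r => Z r i j) (Set.Icc a b)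
  hasDerivWithinAt : ∀ s ∈ Set.Ico a b, ∀ i j,
    HasDerivWithinAt (fun r => Z r i j) ((Z s * Aᵀ - H * Z s * Mᵀ) i j) (Set.Ici s) s

theorem continuousOn_mul_apply {l m n : ℕ} {X : ℝ → Matrix (Fin l) (Fin m) ℝ}
    {Y : ℝ → Matrix (Fin m) (Fin n) ℝ} {u : Set ℝ}
    (hX : ∀ i j, ContinuousOn (fun r => X r i j) u)
    (hY : ∀ i j, ContinuousOn (fun r => Y r i j) u) (i : Fin l) (j : Fin n) :
    ContinuousOn (fun r => (X r * Y r) i j) u := by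
  simp only [Matrix.mul_apply]
  exact continuousOn_finsetSum _ fun k _ => (hX i k).mul (hY k j)

variable {A M : Matrix (Fin n) (Fin n) ℝ} {H : Matrix (Fin N) (Fin N) ℝ}
  {Z : ℝ → Matrix (Fin N) (Fin n) ℝ} {a b : ℝ}

theorem SolvesErrorEquation.const_mul (hZ : SolvesErrorEquation A M H Z a b)
    {T : Matrix (Fin N) (Fin N) ℝ} (hT : T * H = H * T) :
    SolvesErrorEquation A M H (fun s => T * Z s) a b where
  continuousOn := continuousOn_mul_apply (fun _ _ => continuousOn_const) hZ.continuousOn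
  hasDerivWithinAt s hs i j := by
    refine (hasDerivWithinAt_mul_apply (X := fun _ => T) (X' := 0)
      (fun _ _ => hasDerivWithinAt_const _ _ _) (hZ.hasDerivWithinAt s hs) i j).congr_deriv ?_
    rw [Matrix.zero_mul, zero_add, Matrix.mul_sub]
    simp only [← Matrix.mul_assoc, hT]

/-- Multiplication by `T` removes the coupling term, so `T Z` undone by the flow of `Aᵀ` is
constant. It is used with `T` the projection onto `ker H`. -/
theorem SolvesErrorEquation.mul_eq_mul_exp (hZ : SolvesErrorEquation A M H Z a b)
    {T : Matrix (Fin N) (Fin N) ℝ} (hT : T * H = 0) {s : ℝ} (hs : s ∈ Set.Icc a b) :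
    T * Z s = T * Z a * NormedSpace.exp ((s - a) • Aᵀ) := by
  set E : ℝ → Matrix (Fin n) (Fin n) ℝ := fun r => NormedSpace.exp ((a - r) • Aᵀ) with hE
  have hE' : ∀ r, ∀ u : Set ℝ, ∀ i j, HasDerivWithinAt (fun r => E r i j) ((-(Aᵀ * E r)) i j) u r := by
    intro r u i j
    refine ((HasDerivAt.comp r (h₂ := fun r => NormedSpace.exp (r • Aᵀ) i j) (h := fun r => a - r)
      (hasDerivAt_exp_smul_apply Aᵀ (a - r) i j)
      ((hasDerivAt_id' r).const_sub a)).hasDerivWithinAt).congr_deriv ?_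
    rw [Matrix.neg_apply, mul_neg_one]
  have hconst : ∀ r ∈ Set.Icc a b, T * Z r * E r = T * Z a * E a := by
    intro r hr
    ext i j
    refine constant_of_has_deriv_right_zero (f := fun r => (T * Z r * E r) i j) ?_ ?_ r hr
    · exact continuousOn_mul_apply (X := fun r => T * Z r) (Y := E)
        (continuousOn_mul_apply (X := fun _ => T) (fun _ _ => continuousOn_const) hZ.continuousOn)
        (fun i j => (fun r _ => (hE' r _ i j).continuousWithinAt)) i j
    · intro r hr
      refine (hasDerivWithinAt_mul_apply (X := fun r => T * Z r) (Y := E)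
        (hasDerivWithinAt_mul_apply (X := fun _ => T) (X' := 0)
        (fun _ _ => hasDerivWithinAt_const _ _ _) (hZ.hasDerivWithinAt r hr))
        (hE' r _) i j).congr_deriv ?_
      have : ((0 : Matrix (Fin N) (Fin N) ℝ) * Z r + T * (Z r * Aᵀ - H * Z r * Mᵀ)) * E r + T * Z r * -(Aᵀ * E r) = 0 := by
        rw [Matrix.zero_mul, zero_add, Matrix.mul_sub]
        simp only [← Matrix.mul_assoc, hT, Matrix.zero_mul, sub_zero, Matrix.mul_neg]
        simp
      rw [this, Matrix.zero_apply]
  have h1 := hconst s hs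
  have h2 : E s * NormedSpace.exp ((s - a) • Aᵀ) = 1 := by
    rw [hE, ← Matrix.exp_add_of_commute _ _ (((Commute.refl _).smul_left _).smul_right _), ← add_smul]
    simp
  have h3 : E a = 1 := by simp [hE]
  rw [h3, Matrix.mul_one] at h1
  rw [← h1, Matrix.mul_assoc, h2, Matrix.mul_one]

theorem trace_mul_mul_transpose {k : ℕ} (X : Matrix (Fin N) (Fin k) ℝ)
    (Q : Matrix (Fin k) (Fin k) ℝ) (Y : Matrix (Fin N) (Fin k) ℝ) :
    (X * Q * Yᵀ).trace = ∑ i, X i ⬝ᵥ (Q *ᵥ Y i) := by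
  simp only [Matrix.trace, Matrix.diag_apply]
  refine Finset.sum_congr rfl fun i _ => ?_
  rw [Matrix.mul_assoc, Matrix.mul_apply, dotProduct]
  refine Finset.sum_congr rfl fun j _ => ?_
  rw [Matrix.mul_apply, mulVec, dotProduct]
  rfl

/-- Dissipation inequality for the Lyapunov function `trace (Y W⁻¹ Yᵀ)` of the error equation. -/
theorem trace_mul_inv_mul_transpose_le {B : Matrix (Fin n) (Fin m) ℝ}
    {W : Matrix (Fin n) (Fin n) ℝ} (hW : W.PosDef) {α μ : ℝ}
    (hlyap : ∀ y : Fin n → ℝ, α * (y ⬝ᵥ (W *ᵥ y)) + (y ᵥ* A) ⬝ᵥ (W *ᵥ y) ≤ (y ᵥ* B) ⬝ᵥ (y ᵥ* B))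
    (hH : Hᵀ = H)
    (hco : ∀ x : Fin N → ℝ, (∀ v, H *ᵥ v = 0 → v ⬝ᵥ x = 0) → x ⬝ᵥ x ≤ μ * (x ⬝ᵥ (H *ᵥ x)))
    {Y : Matrix (Fin N) (Fin n) ℝ} (hY : ∀ v, H *ᵥ v = 0 → v ᵥ* Y = 0) :
    (Y * W⁻¹ * (Y * Aᵀ - H * Y * (B * (μ • (Bᵀ * W⁻¹)))ᵀ)ᵀ).trace ≤
      -α * (Y * W⁻¹ * Yᵀ).trace := by
  have hWt := hW.transpose_eq
  have hQt : (W⁻¹)ᵀ = W⁻¹ := hW.inv.transpose_eq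
  have hdet := (Matrix.isUnit_iff_isUnit_det _).1 hW.isUnit
  -- The Lyapunov inequality is applied to the rows of `U`, the spectral gap to the columns of `D =
  -- U B`.
  set U := Y * W⁻¹ with hU
  have hYU : Y = U * W := by rw [hU, Matrix.mul_assoc, Matrix.nonsing_inv_mul _ hdet, Matrix.mul_one]
  set D := U * B with hD
  have h1 : (U * (Y * Aᵀ - H * Y * (B * (μ • (Bᵀ * W⁻¹)))ᵀ)ᵀ).trace =
      (U * A * W * Uᵀ).trace - μ * (Dᵀ * H * Dᵀᵀ).trace := by
    have e1 : U * (Y * Aᵀ)ᵀ = U * A * W * Uᵀ := by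
      rw [hYU, Matrix.transpose_mul, Matrix.transpose_mul, hWt, Matrix.transpose_transpose]
      simp only [Matrix.mul_assoc]
    have e2 : U * (H * Y * (B * (μ • (Bᵀ * W⁻¹)))ᵀ)ᵀ = μ • (D * (Dᵀ * H)) := by
      have e3 : Dᵀ = Bᵀ * (W⁻¹ * Yᵀ) := by
        rw [hD, hU, Matrix.transpose_mul, Matrix.transpose_mul, hQt]
      rw [e3, Matrix.transpose_mul, Matrix.transpose_transpose, Matrix.transpose_mul, hH, hD]
      simp only [Matrix.mul_smul, Matrix.smul_mul, Matrix.mul_assoc]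
    rw [Matrix.transpose_sub, Matrix.mul_sub, Matrix.trace_sub, e1, e2, Matrix.trace_smul,
      Matrix.trace_mul_comm D, Matrix.transpose_transpose, smul_eq_mul]
  -- The columns of `D` inherit orthogonality to `ker H` from `Y`; this is what permits the use of
  -- `hco`.
  have hDk : ∀ l, ∀ v, H *ᵥ v = 0 → v ⬝ᵥ Dᵀ l = 0 := by
    intro l v hv
    have h2 : v ᵥ* D = 0 := by
      rw [hD, hU, ← Matrix.vecMul_vecMul, ← Matrix.vecMul_vecMul, hY v hv, Matrix.zero_vecMul,
        Matrix.zero_vecMul]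
    exact congrFun h2 l
  have h2 : ∑ i, (U i ᵥ* B) ⬝ᵥ (U i ᵥ* B) ≤ μ * (Dᵀ * H * Dᵀᵀ).trace := by
    have h3 : ∑ i, (U i ᵥ* B) ⬝ᵥ (U i ᵥ* B) = ∑ l, Dᵀ l ⬝ᵥ Dᵀ l := by
      simp only [dotProduct]
      rw [Finset.sum_comm]
      rfl
    rw [h3, trace_mul_mul_transpose, Finset.mul_sum]
    exact Finset.sum_le_sum fun l _ => hco _ (hDk l)
  have h3 : (U * A * W * Uᵀ).trace = ∑ i, (U i ᵥ* A) ⬝ᵥ (W *ᵥ U i) := by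
    rw [trace_mul_mul_transpose]
    rfl
  have h4 : (U * Yᵀ).trace = ∑ i, U i ⬝ᵥ (W *ᵥ U i) := by
    rw [← trace_mul_mul_transpose]
    rw [Matrix.mul_assoc]
    congr 2
    have := congrArg transpose hYU
    rw [Matrix.transpose_mul, hWt] at this
    rw [this, ← Matrix.mul_assoc, Matrix.nonsing_inv_mul _ hdet, Matrix.one_mul]
  rw [h1, h3, h4, neg_mul, Finset.mul_sum]
  have h5 := Finset.sum_le_sum fun i (_ : i ∈ Finset.univ) => hlyap (U i)
  rw [Finset.sum_add_distrib] at h5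
  linarith

theorem SolvesErrorEquation.trace_le {B : Matrix (Fin n) (Fin m) ℝ}
    {W : Matrix (Fin n) (Fin n) ℝ} (hW : W.PosDef) {α μ : ℝ}
    (hlyap : ∀ y : Fin n → ℝ, α * (y ⬝ᵥ (W *ᵥ y)) + (y ᵥ* A) ⬝ᵥ (W *ᵥ y) ≤ (y ᵥ* B) ⬝ᵥ (y ᵥ* B))
    (hH : Hᵀ = H)
    (hco : ∀ x : Fin N → ℝ, (∀ v, H *ᵥ v = 0 → v ⬝ᵥ x = 0) → x ⬝ᵥ x ≤ μ * (x ⬝ᵥ (H *ᵥ x)))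
    (hZ : SolvesErrorEquation A (B * (μ • (Bᵀ * W⁻¹))) H Z a b)
    (hker : ∀ s, ∀ v, H *ᵥ v = 0 → v ᵥ* Z s = 0) {s : ℝ} (hs : s ∈ Set.Icc a b) :
    (Z s * W⁻¹ * (Z s)ᵀ).trace ≤ Real.exp (-2 * α * (s - a)) * (Z a * W⁻¹ * (Z a)ᵀ).trace := by
  have hQt : (W⁻¹)ᵀ = W⁻¹ := hW.inv.transpose_eq
  set V : ℝ → ℝ := fun r => (Z r * W⁻¹ * (Z r)ᵀ).trace with hV
  set R : ℝ → Matrix (Fin N) (Fin n) ℝ := fun r =>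
    Z r * Aᵀ - H * Z r * (B * (μ • (Bᵀ * W⁻¹)))ᵀ with hR
  have hZc := hZ.continuousOn
  have hVc : ContinuousOn V (Set.Icc a b) := by
    simp only [hV, Matrix.trace, Matrix.diag_apply]
    refine continuousOn_finsetSum _ fun i _ => continuousOn_mul_apply (X := fun r => Z r * W⁻¹)
      (Y := fun r => (Z r)ᵀ) (continuousOn_mul_apply (Y := fun _ => W⁻¹) hZc
        fun _ _ => continuousOn_const) (fun i j => hZc j i) i i
  have hVd : ∀ r ∈ Set.Ico a b,
      HasDerivWithinAt V (2 * (Z r * W⁻¹ * (R r)ᵀ).trace) (Set.Ici r) r := by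
    intro r hr
    have hd := hZ.hasDerivWithinAt r hr
    have h1 : HasDerivWithinAt V (((R r * W⁻¹ + Z r * (0 : Matrix (Fin n) (Fin n) ℝ)) * (Z r)ᵀ + Z r * W⁻¹ * (R r)ᵀ).trace)
        (Set.Ici r) r := by
      simp only [hV, Matrix.trace, Matrix.diag_apply]
      exact HasDerivWithinAt.fun_sum fun i _ => hasDerivWithinAt_mul_apply
        (X := fun r => Z r * W⁻¹)
        (hasDerivWithinAt_mul_apply (X' := R r) hd (Y := fun _ => W⁻¹) (Y' := 0)
          fun _ _ => hasDerivWithinAt_const _ _ _) (Y := fun r => (Z r)ᵀ) (Y' := (R r)ᵀ)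
          (fun i j => hd j i) i i
    refine h1.congr_deriv ?_
    have h2 : (R r * W⁻¹ * (Z r)ᵀ).trace = (Z r * W⁻¹ * (R r)ᵀ).trace := by
      rw [← Matrix.trace_transpose, Matrix.transpose_mul, Matrix.transpose_mul, hQt,
        Matrix.transpose_transpose, Matrix.mul_assoc]
    rw [Matrix.mul_zero, add_zero, Matrix.trace_add, h2, two_mul]
  have hexp : ∀ r, ∀ u : Set ℝ, HasDerivWithinAt (fun r => Real.exp (2 * α * (r - a)))
      (Real.exp (2 * α * (r - a)) * (2 * α)) u r := by
    intro r u
    simpa using ((((hasDerivAt_id' r).sub_const a).const_mul (2 * α)).exp).hasDerivWithinAt (s := u)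
  -- Gronwall: `exp (2α (r - a)) V r` has nonpositive right derivative.
  have key := image_le_of_deriv_right_le_deriv_boundary
    (f := fun r => Real.exp (2 * α * (r - a)) * V r)
    (f' := fun r => Real.exp (2 * α * (r - a)) * (2 * α) * V r +
      Real.exp (2 * α * (r - a)) * (2 * (Z r * W⁻¹ * (R r)ᵀ).trace))
    (B := fun _ => V a) (B' := fun _ => 0) (a := a) (b := b)
    ((ContinuousOn.mul (by fun_prop) hVc)) (fun r hr => (hexp r _).fun_mul (hVd r hr))
    (by simp) continuousOn_const (fun r _ => hasDerivWithinAt_const _ _ _) (fun r hr => by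
      have h1 := trace_mul_inv_mul_transpose_le hW hlyap hH hco (hker r)
      have h2 := Real.exp_pos (2 * α * (r - a))
      have h3 : (Z r * W⁻¹ * (R r)ᵀ).trace ≤ -α * V r := h1
      nlinarith) hs
  have h1 : Real.exp (-2 * α * (s - a)) = (Real.exp (2 * α * (s - a)))⁻¹ := by
    rw [← Real.exp_neg]; congr 1; ring
  rw [h1, ← div_eq_inv_mul, le_div_iff₀ (Real.exp_pos _), mul_comm]
  exact key

open scoped Matrix.Norms.Frobenius

theorem frobenius_norm_sq_eq_sum_dotProduct (X : Matrix (Fin N) (Fin n) ℝ) :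
    ‖X‖ ^ 2 = ∑ i, X i ⬝ᵥ X i := by
  rw [frobenius_norm_sq]
  simp only [dotProduct, sq]

/-- The Lyapunov function yields decay `exp (-α (s - a))` of the norm, and its comparison with the
norm costs at most `D exp (α τ / 2)`. It is essential that `D` is chosen before `α`, `H` and `μ`. -/
theorem exists_norm_one_sub_kerProjMatrix_mul_le {B : Matrix (Fin n) (Fin m) ℝ}
    (hctrl : Controllable A B) {T τ : ℝ} (hT : 0 < T) (hτ : 0 < τ) :
    ∃ D, 0 < D ∧ ∀ α, 0 < α → ∀ (N : ℕ) (H : Matrix (Fin N) (Fin N) ℝ) (μ : ℝ), Hᵀ = H →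
      (∀ x : Fin N → ℝ, (∀ v, H *ᵥ v = 0 → v ⬝ᵥ x = 0) → x ⬝ᵥ x ≤ μ * (x ⬝ᵥ (H *ᵥ x))) →
      ∀ (Z : ℝ → Matrix (Fin N) (Fin n) ℝ) (a b : ℝ),
      SolvesErrorEquation A (B * (μ • (Bᵀ * (gramian A B α T)⁻¹))) H Z a b →
      ∀ s ∈ Set.Icc a b, ‖(1 - kerProjMatrix H) * Z s‖ ≤
        D * Real.exp (α * (τ / 2 - (s - a))) * ‖Z a‖ := by
  -- `ε ≤ T` is needed to truncate the Gramian, `ε ≤ τ` to let the dwell time win over the loss `exp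
  -- (α ε / 2)`.
  set ε := min T τ
  have hε : 0 < ε := lt_min hT hτ
  obtain ⟨c, hc, hclow⟩ := exists_le_dotProduct_mulVec (gramian_posDef hctrl 0 hε)
  obtain ⟨C, hC, hCup⟩ := exists_dotProduct_mulVec_le (gramian A B 0 T)
  refine ⟨Real.sqrt (C / c), Real.sqrt_pos.2 (div_pos hC hc), ?_⟩
  intro α hα N H μ hH hco Z a b hZ s hs
  set W := gramian A B α T
  have hW : W.PosDef := gramian_posDef hctrl α hT
  have hup : ∀ x, x ⬝ᵥ (W *ᵥ x) ≤ C * (x ⬝ᵥ x) := fun x =>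
    (gramian_upper_bound hα.le hT.le x).trans (hCup x)
  have hlow : ∀ x, (c * Real.exp (-α * ε)) * (x ⬝ᵥ x) ≤ x ⬝ᵥ (W *ᵥ x) := fun x => by
    refine le_trans ?_ (gramian_lower_bound hα.le hε.le (min_le_left _ _) x)
    rw [mul_comm c, mul_assoc]
    exact mul_le_mul_of_nonneg_left (hclow x) (Real.exp_nonneg _)
  have hcpos : 0 < c * Real.exp (-α * ε) := by positivity
  have hPH := kerProjMatrix_mul hH
  have hHP := mul_kerProjMatrix H
  have hcomm : (1 - kerProjMatrix H) * H = H * (1 - kerProjMatrix H) := by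
    rw [Matrix.sub_mul, Matrix.mul_sub, hPH, hHP, Matrix.one_mul, Matrix.mul_one]
  have hY := hZ.const_mul hcomm
  have hdecay := hY.trace_le hW (gramian_lyapunov α T) hH hco (fun r v hv => by
    rw [← Matrix.vecMul_vecMul, vecMul_one_sub_kerProjMatrix hv, Matrix.zero_vecMul]) hs
  simp only [trace_mul_mul_transpose] at hdecay
  set Y : ℝ → Matrix (Fin N) (Fin n) ℝ := fun r => (1 - kerProjMatrix H) * Z r
  have h1 : ‖Y s‖ ^ 2 ≤ C * ∑ i, Y s i ⬝ᵥ (W⁻¹ *ᵥ Y s i) := by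
    rw [frobenius_norm_sq_eq_sum_dotProduct, Finset.mul_sum]
    exact Finset.sum_le_sum fun i _ => dotProduct_self_le_mul_inv hW hC hup _
  have h2 : (c * Real.exp (-α * ε)) * ∑ i, Y a i ⬝ᵥ (W⁻¹ *ᵥ Y a i) ≤ ‖Y a‖ ^ 2 := by
    rw [frobenius_norm_sq_eq_sum_dotProduct, Finset.mul_sum]
    exact Finset.sum_le_sum fun i _ => mul_dotProduct_inv_mulVec_le hW hcpos hlow _
  have h3 : ‖Y a‖ ≤ ‖Z a‖ := norm_one_sub_kerProjMatrix_mul_le H (Z a)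
  have h4 : ∑ i, Y a i ⬝ᵥ (W⁻¹ *ᵥ Y a i) ≤ (c * Real.exp (-α * ε))⁻¹ * ‖Z a‖ ^ 2 := by
    rw [← div_eq_inv_mul, le_div_iff₀ hcpos, mul_comm]
    exact h2.trans (pow_le_pow_left₀ (norm_nonneg _) h3 2)
  refine le_of_sq_le_sq ?_ (by positivity)
  calc ‖Y s‖ ^ 2 ≤ C * (Real.exp (-2 * α * (s - a)) *
        ((c * Real.exp (-α * ε))⁻¹ * ‖Z a‖ ^ 2)) := h1.trans (by gcongr; exact hdecay.trans (by gcongr))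
    _ = C / c * (Real.exp (-2 * α * (s - a)) * Real.exp (α * ε)) * ‖Z a‖ ^ 2 := by
      have : Real.exp (α * ε) = (Real.exp (-α * ε))⁻¹ := by rw [← Real.exp_neg]; congr 1; ring
      rw [this, mul_inv]
      ring
    _ ≤ C / c * Real.exp (α * (τ / 2 - (s - a))) ^ 2 * ‖Z a‖ ^ 2 := by
      have hle : ε ≤ τ := min_le_right _ _
      rw [← Real.exp_add, sq (Real.exp _), ← Real.exp_add]
      refine mul_le_mul_of_nonneg_right (mul_le_mul_of_nonneg_left (Real.exp_le_exp.2 ?_)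
        (div_pos hC hc).le) (sq_nonneg _)
      nlinarith
    _ = (Real.sqrt (C / c) * Real.exp (α * (τ / 2 - (s - a))) * ‖Z a‖) ^ 2 := by
      rw [mul_pow, mul_pow, Real.sq_sqrt (div_pos hC hc).le]

end ErrorDynamics

/-! ### Exponential decay over blocks of windows -/

section Decay

theorem exists_le_lt_succ {α : Type*} [LinearOrder α] {f : ℕ → α} {x : α} (h0 : f 0 ≤ x)
    (h : ∃ n, x < f n) : ∃ k, f k ≤ x ∧ x < f (k + 1) := by
  classical
  have h1 := Nat.find_spec h
  obtain ⟨k, hk⟩ : ∃ k, Nat.find h = k + 1 := Nat.exists_eq_succ_of_ne_zero fun h2 => by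
    rw [h2] at h1
    exact absurd h1 (not_lt.2 h0)
  refine ⟨k, not_lt.1 (Nat.find_min h (by omega)), ?_⟩
  rwa [hk] at h1

theorem SwitchingSignal.exists_mem_Ico {P : Type*} (S : SwitchingSignal P) {s : ℝ} (hs : 0 ≤ s) :
    ∃ j, s ∈ Set.Ico (S.t j) (S.t (j + 1)) := by
  refine exists_le_lt_succ (f := S.t) (by rwa [S.t_zero]) ?_
  obtain ⟨l, hl⟩ := exists_nat_gt (s / S.τ)
  refine ⟨l, ?_⟩
  have h1 := S.mul_le_t_sub 0 l
  rw [S.t_zero, sub_zero, zero_add] at h1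
  exact ((div_lt_iff₀ S.τ_pos).1 hl).trans_le h1

section JointConnectivity

variable {P : Type*} {N : ℕ} {S : SwitchingSignal P} {G : P → Digraph (Fin (N + 1))}
  {jk : ℕ → ℕ} {Tc : ℝ}

theorem JointlyConnected.zero (h : JointlyConnected S G jk Tc) : jk 0 = 0 :=
  S.t_strictMono.injective (h.start.trans S.t_zero.symm)

theorem JointlyConnected.t_sub_le (h : JointlyConnected S G jk Tc) (k l : ℕ) :
    S.t (jk (k + l)) - S.t (jk k) ≤ l * Tc := by
  induction l with
  | zero => simp
  | succ l ih =>
    have := h.window (k + l)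
    rw [← add_assoc]
    push_cast
    linarith

theorem JointlyConnected.t_succ_sub_le (h : JointlyConnected S G jk Tc) (j : ℕ) :
    S.t (j + 1) - S.t j ≤ Tc := by
  obtain ⟨k, hk1, hk2⟩ := exists_le_lt_succ (f := jk) (x := j) (by simp [h.zero])
    ⟨j + 1, h.strictMono.le_apply⟩
  have h1 := S.t_strictMono.monotone hk1
  have h2 := S.t_strictMono.monotone (Nat.succ_le_of_lt hk2)
  have h3 := h.window k
  simp only [Nat.succ_eq_add_one] at h2
  linarith

theorem JointlyConnected.sub_le (h : JointlyConnected S G jk Tc) (k l : ℕ) :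
    ((jk (k + l) - jk k : ℕ) : ℝ) ≤ l * Tc / S.τ := by
  have h1 := S.mul_le_t_sub (jk k) (jk (k + l) - jk k)
  rw [Nat.add_sub_cancel' (h.strictMono.monotone (Nat.le_add_right k l))] at h1
  exact (le_div_iff₀ S.τ_pos).2 (h1.trans (h.t_sub_le k l))

theorem norm_orderedProd_kerProj_le_pow (h : JointlyConnected S G jk Tc) {δ : ℝ} (hδ : 0 ≤ δ)
    (hb : ProjectionProductsBounded S G jk δ) (k l : ℕ) :
    ‖orderedProd (fun r => kerProj (leaderFollowerMatrix (G (S.σ (S.t r)))))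
      (jk k) (jk (k + l) - jk k)‖ ≤ δ ^ l := by
  induction l with
  | zero =>
    rw [Nat.add_zero, Nat.sub_self, pow_zero]
    exact ContinuousLinearMap.norm_id_le
  | succ l ih =>
    have h1 := h.strictMono.monotone (Nat.le_add_right k l)
    have h2 := (h.strictMono (Nat.lt_succ_self (k + l))).le
    simp only [Nat.succ_eq_add_one] at h2
    have h3 : jk (k + (l + 1)) - jk k = (jk (k + l) - jk k) + (jk (k + l + 1) - jk (k + l)) := by
      rw [← add_assoc]; omega
    rw [h3, orderedProd_add, Nat.add_sub_cancel' h1, pow_succ']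
    exact (norm_mul_le _ _).trans (mul_le_mul (hb _) ih (norm_nonneg _) hδ)

end JointConnectivity

open scoped Matrix.Norms.Frobenius

/-- The exact step multiplies by `P j` on the left and by an exponential on the right, so `l` steps
collect into an ordered product and one exponential. Each step adds a defect of relative size `η`
and magnifies earlier ones by at most `κ`; since `η ≤ 1`, the states grow by at most `κ + 1` per
step. -/
theorem norm_sub_orderedProd_mul_exp_le {N n : ℕ} {P : ℕ → Matrix (Fin N) (Fin N) ℝ}
    (hP : ∀ j (X : Matrix (Fin N) (Fin n) ℝ), ‖P j * X‖ ≤ ‖X‖) {A : Matrix (Fin n) (Fin n) ℝ}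
    {t : ℕ → ℝ} {κ : ℝ} (hκ0 : 0 ≤ κ)
    (hκ : ∀ j (X : Matrix (Fin N) (Fin n) ℝ),
      ‖X * NormedSpace.exp ((t (j + 1) - t j) • A)‖ ≤ κ * ‖X‖)
    {η : ℝ} (hη0 : 0 ≤ η) (hη1 : η ≤ 1) {z : ℕ → Matrix (Fin N) (Fin n) ℝ}
    (hz : ∀ j, ‖z (j + 1) - P j * z j * NormedSpace.exp ((t (j + 1) - t j) • A)‖ ≤ η * ‖z j‖)
    (a l : ℕ) :
    ‖z (a + l)‖ ≤ (κ + 1) ^ l * ‖z a‖ ∧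
      ‖z (a + l) - orderedProd P a l * z a * NormedSpace.exp ((t (a + l) - t a) • A)‖ ≤
        η * l * (κ + 1) ^ l * ‖z a‖ := by
  induction l with
  | zero => simp [orderedProd]
  | succ l ih =>
    obtain ⟨ih1, ih2⟩ := ih
    have hs := hz (a + l)
    set E := NormedSpace.exp ((t (a + l + 1) - t (a + l)) • A) with hE
    have hκ' : ∀ X : Matrix (Fin N) (Fin n) ℝ, ‖P (a + l) * X * E‖ ≤ κ * ‖X‖ := fun X =>
      (hκ _ _).trans (mul_le_mul_of_nonneg_left (hP _ _) hκ0)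
    rw [← add_assoc]
    constructor
    · calc ‖z (a + l + 1)‖ ≤ ‖z (a + l + 1) - P (a + l) * z (a + l) * E‖ +
            ‖P (a + l) * z (a + l) * E‖ := by
            simpa using norm_add_le (z (a + l + 1) - P (a + l) * z (a + l) * E)
              (P (a + l) * z (a + l) * E)
        _ ≤ 1 * ‖z (a + l)‖ + κ * ‖z (a + l)‖ := add_le_add (hs.trans (by gcongr)) (hκ' _)
        _ = (κ + 1) * ‖z (a + l)‖ := by ring
        _ ≤ (κ + 1) * ((κ + 1) ^ l * ‖z a‖) := by gcongr
        _ = (κ + 1) ^ (l + 1) * ‖z a‖ := by ring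
    · have h1 : NormedSpace.exp ((t (a + l + 1) - t a) • A) =
          NormedSpace.exp ((t (a + l) - t a) • A) * E := by
        rw [hE, ← Matrix.exp_add_of_commute _ _ (((Commute.refl _).smul_left _).smul_right _),
          ← add_smul]
        congr 2
        ring
      have h2 : z (a + l + 1) - orderedProd P a (l + 1) * z a *
          NormedSpace.exp ((t (a + l + 1) - t a) • A) =
          (z (a + l + 1) - P (a + l) * z (a + l) * E) + P (a + l) *
            (z (a + l) - orderedProd P a l * z a * NormedSpace.exp ((t (a + l) - t a) • A)) * E := by
        rw [h1, orderedProd, Matrix.mul_sub, Matrix.sub_mul]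
        simp only [Matrix.mul_assoc]
        abel
      rw [h2]
      calc _ ≤ η * ‖z (a + l)‖ + κ * (η * l * (κ + 1) ^ l * ‖z a‖) :=
            (norm_add_le _ _).trans (add_le_add hs ((hκ' _).trans (by gcongr)))
        _ ≤ η * ((κ + 1) ^ l * ‖z a‖) + κ * (η * l * (κ + 1) ^ l * ‖z a‖) := by gcongr
        _ ≤ η * ((κ + 1) ^ l * ‖z a‖) * (κ + 1) + κ * (η * l * (κ + 1) ^ l * ‖z a‖) +
              η * l * (κ + 1) ^ l * ‖z a‖ := by
            have e1 : 0 ≤ η * ((κ + 1) ^ l * ‖z a‖) * κ := by positivity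
            have e2 : 0 ≤ η * l * (κ + 1) ^ l * ‖z a‖ := by positivity
            linarith
        _ = η * ((l + 1 : ℕ) : ℝ) * (κ + 1) ^ (l + 1) * ‖z a‖ := by push_cast; ring

/-- Along solutions of the switched error equation, exponential decay from the contraction of
blocks of `K` windows. -/
theorem norm_le_of_contraction {P : Type*} {N n : ℕ} {S : SwitchingSignal P}
    {G : P → Digraph (Fin (N + 1))} {jk : ℕ → ℕ} {Tc : ℝ} (hconn : JointlyConnected S G jk Tc)
    {K : ℕ} (hK : 1 ≤ K) {c : ℝ} (hc : 0 ≤ c) {Z : ℝ → Matrix (Fin N) (Fin n) ℝ}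
    (hhalf : ∀ q, ‖Z (S.t (jk ((q + 1) * K)))‖ ≤ 1 / 2 * ‖Z (S.t (jk (q * K)))‖)
    (hblock : ∀ q, ∀ s ∈ Set.Ico (S.t (jk (q * K))) (S.t (jk ((q + 1) * K))),
      ‖Z s‖ ≤ c * ‖Z (S.t (jk (q * K)))‖) {s : ℝ} (hs : 0 ≤ s) :
    ‖Z s‖ ≤ 2 * c * Real.exp (-(Real.log 2 / (K * Tc)) * s) * ‖Z 0‖ := by
  have hpow : ∀ q : ℕ, ‖Z (S.t (jk (q * K)))‖ ≤ (1 / 2) ^ q * ‖Z 0‖ := by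
    intro q
    induction q with
    | zero => simp [hconn.start]
    | succ q ih =>
      refine (hhalf q).trans ?_
      rw [pow_succ', mul_assoc]
      gcongr
  obtain ⟨q, hq⟩ := exists_le_lt_succ (f := fun q => S.t (jk (q * K))) (x := s)
    (by simpa [hconn.start] using hs) (by
      obtain ⟨j, hj⟩ := S.exists_mem_Ico hs
      refine ⟨j + 1, hj.2.trans_le (S.t_strictMono.monotone ?_)⟩
      exact (Nat.le_mul_of_pos_right _ hK).trans hconn.strictMono.le_apply)
  have hTc := hconn.Tc_pos
  have hK0 : (0 : ℝ) < K := by exact_mod_cast hK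
  have h1 : s ≤ (q + 1 : ℝ) * K * Tc := by
    have := hconn.t_sub_le 0 ((q + 1) * K)
    rw [zero_add, hconn.start, sub_zero] at this
    push_cast at this
    exact hq.2.le.trans this
  -- The factor `2` pays for the unfinished block containing `s`.
  have h2 : ((1 : ℝ) / 2) ^ q ≤ 2 * Real.exp (-(Real.log 2 / (K * Tc)) * s) := by
    have e1 : ((1 : ℝ) / 2) ^ q = Real.exp (-(q * Real.log 2)) := by
      rw [Real.exp_neg, Real.exp_nat_mul, Real.exp_log (by norm_num), one_div, inv_pow]
    have e2 : (2 : ℝ) * Real.exp (-(Real.log 2 / (K * Tc)) * s) =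
        Real.exp (Real.log 2 + -(Real.log 2 / (K * Tc)) * s) := by
      rw [Real.exp_add, Real.exp_log (by norm_num)]
    rw [e1, e2, Real.exp_le_exp]
    have e3 : s / (K * Tc) ≤ q + 1 := by
      rw [div_le_iff₀ (by positivity)]; linarith
    have e4 : Real.log 2 / (K * Tc) * s = Real.log 2 * (s / (K * Tc)) := by ring
    have e5 : 0 ≤ Real.log 2 := Real.log_nonneg (by norm_num)
    nlinarith
  calc ‖Z s‖ ≤ c * ((1 / 2) ^ q * ‖Z 0‖) := (hblock q s hq).trans (by gcongr; exact hpow q)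
    _ ≤ c * ((2 * Real.exp (-(Real.log 2 / (K * Tc)) * s)) * ‖Z 0‖) := by gcongr
    _ = _ := by ring

/-- The order of choices matters: first `ρ`, then the block length `K`, then `α₀`, so that the ideal
block map contracts to `1 / 4` and the accumulated defect adds at most another `1 / 4`. Only the
final constant `c` depends on `α`. -/
theorem exists_norm_le_mul_exp_mul {P : Type*} {N n m : ℕ} {A : Matrix (Fin n) (Fin n) ℝ}
    {B : Matrix (Fin n) (Fin m) ℝ} {S : SwitchingSignal P} {G : P → Digraph (Fin (N + 1))}
    {jk : ℕ → ℕ} {Tc δ T : ℝ} (hloop : ∀ p i, ¬ (G p).Adj i i) (hctrl : Controllable A B)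
    (hundir : ∀ j, IsUndirected (followerSubgraph (G (S.σ (S.t j)))))
    (hconn : JointlyConnected S G jk Tc) (hδ0 : 0 < δ) (hδ1 : δ < 1)
    (hδ : ProjectionProductsBounded S G jk δ) (hA : lambdaMax A < -(Real.log δ) / Tc)
    (hT : 0 < T) :
    ∃ α₀ : ℝ, 0 < α₀ ∧ ∀ α, α₀ < α → ∀ μ, 1 / lambdaH N ≤ μ →
      ∃ c > 0, ∃ γ > 0, ∀ Z : ℝ → Matrix (Fin N) (Fin n) ℝ,
        (∀ j, SolvesErrorEquation A (B * (μ • (Bᵀ * (gramian A B α T)⁻¹)))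
          (leaderFollowerMatrix (G (S.σ (S.t j)))) Z (S.t j) (S.t (j + 1))) →
        ∀ s, 0 ≤ s → ‖Z s‖ ≤ c * Real.exp (-γ * s) * ‖Z 0‖ := by
  have hTc := hconn.Tc_pos
  have hlog : 0 < -(Real.log δ) / Tc := div_pos (neg_pos.2 (Real.log_neg hδ0 hδ1)) hTc
  -- Also `ρ > 0`, so that growth over a shorter time is bounded by growth over a longer one even
  -- when `A` is stable.
  obtain ⟨ρ, hρ1, hρ2⟩ := exists_between (max_lt hA hlog)
  have hρA : lambdaMax A < ρ := (le_max_left _ _).trans_lt hρ1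
  have hρ0 : 0 < ρ := (le_max_right _ _).trans_lt hρ1
  obtain ⟨C, hC, hCexp⟩ := exists_norm_exp_smul_le A hρA
  have hexp : ∀ (X : Matrix (Fin N) (Fin n) ℝ) (h R : ℝ), 0 ≤ h → h ≤ R →
      ‖X * NormedSpace.exp (h • Aᵀ)‖ ≤ C * Real.exp (ρ * R) * ‖X‖ := by
    intro X h R h0 hR
    have e1 : NormedSpace.exp (h • Aᵀ) = (NormedSpace.exp (h • A))ᵀ := by
      rw [← Matrix.exp_transpose, Matrix.transpose_smul]
    refine (Matrix.frobenius_norm_mul _ _).trans ?_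
    rw [e1, Matrix.frobenius_norm_transpose, mul_comm]
    refine mul_le_mul_of_nonneg_right ((hCexp h h0).trans ?_) (norm_nonneg _)
    gcongr
  obtain ⟨D, hD, hDbound⟩ := exists_norm_one_sub_kerProjMatrix_mul_le hctrl hT S.τ_pos
  -- the number of windows in a block
  have hbase : δ * Real.exp (ρ * Tc) < 1 := by
    rw [lt_div_iff₀ hTc] at hρ2
    calc δ * Real.exp (ρ * Tc) = Real.exp (Real.log δ + ρ * Tc) := by
          rw [Real.exp_add, Real.exp_log hδ0]
      _ < 1 := by rw [Real.exp_lt_one_iff]; linarith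
  -- `C` enters once per block rather than once per window, so a long block absorbs it.
  obtain ⟨K, hK4, hK1⟩ := (((tendsto_pow_atTop_nhds_zero_of_lt_one (by positivity)
    hbase).eventually (gt_mem_nhds (show (0 : ℝ) < 1 / (4 * C) by positivity))).and
      (Filter.eventually_ge_atTop 1)).exists
  obtain ⟨L, hL⟩ := exists_nat_ge (K * Tc / S.τ)
  set κ := C * Real.exp (ρ * Tc) with hκ
  have hκ0 : 0 ≤ κ := by positivity
  -- The single inequality `η Θ ≤ 1` will give both `η ≤ 1` and `η L (κ + 1) ^ L ≤ 1 / 4`.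
  set Θ : ℝ := 4 * L * (κ + 1) ^ L + 1 with hΘ
  have hΘ1 : 1 ≤ Θ := le_add_of_nonneg_left (by positivity)
  have hΘ0 : 0 < Θ := by linarith
  have hτ := S.τ_pos
  -- From `exp x ≥ 1 + x` at `x = α τ / 2`; no knowledge of `μ` is needed.
  refine ⟨2 * (D * Θ) / S.τ, by positivity, fun α hα μ hμ => ?_⟩
  have hα0 : 0 < α := lt_trans (by positivity) hα
  set η := D * Real.exp (-(α * S.τ / 2)) with hη
  have hη0 : 0 ≤ η := by positivity
  have hηΘ : η * Θ ≤ 1 := by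
    have e1 : D * Θ ≤ α * S.τ / 2 := by
      rw [div_lt_iff₀ hτ] at hα; linarith
    have e2 : D * Θ ≤ Real.exp (α * S.τ / 2) := by
      linarith [Real.add_one_le_exp (α * S.τ / 2)]
    rw [hη, Real.exp_neg, mul_right_comm, ← div_eq_mul_inv, div_le_one (Real.exp_pos _)]
    exact e2
  have hη1 : η ≤ 1 := (le_mul_of_one_le_right hη0 hΘ1).trans hηΘ
  -- Shortly after a switch the complement may overshoot by `D exp (α τ / 2)`; this enlarges the
  -- constant but not the rate.
  set κ' := κ + D * Real.exp (α * S.τ / 2) with hκ'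
  refine ⟨2 * (κ' * (κ + 1) ^ L), by positivity, Real.log 2 / (K * Tc), ?_, ?_⟩
  · have : (0 : ℝ) < K := by exact_mod_cast hK1
    exact div_pos (Real.log_pos (by norm_num)) (by positivity)
  intro Z hZ
  have hsymm := fun j => leaderFollowerMatrix_isSymm (hundir j)
  have hcompl := fun j => hDbound α hα0 N _ μ (hsymm j)
    (dotProduct_self_le_of_inv_lambdaH_le (hundir j) (hloop _) hμ) Z _ _ (hZ j)
  have hkern := fun j s hs => (hZ j).mul_eq_mul_exp (kerProjMatrix_mul (hsymm j)) (s := s) hs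
  set Pr : ℕ → Matrix (Fin N) (Fin N) ℝ := fun j =>
    kerProjMatrix (leaderFollowerMatrix (G (S.σ (S.t j)))) with hPr
  have hsplit : ∀ j s, Z s = Pr j * Z s + (1 - Pr j) * Z s := fun j s => by
    rw [← Matrix.add_mul, add_sub_cancel, Matrix.one_mul]
  have hstep : ∀ j, ‖Z (S.t (j + 1)) - Pr j * Z (S.t j) *
      NormedSpace.exp ((S.t (j + 1) - S.t j) • Aᵀ)‖ ≤ η * ‖Z (S.t j)‖ := by
    intro j
    have hmem : S.t (j + 1) ∈ Set.Icc (S.t j) (S.t (j + 1)) :=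
      ⟨(S.t_strictMono (Nat.lt_succ_self j)).le, le_rfl⟩
    have hsub : Z (S.t (j + 1)) - Pr j * Z (S.t (j + 1)) = (1 - Pr j) * Z (S.t (j + 1)) := by
      rw [Matrix.sub_mul, Matrix.one_mul]
    rw [← hkern j _ hmem, hsub]
    refine (hcompl j _ hmem).trans ?_
    have := S.dwell j
    rw [hη]
    refine mul_le_mul_of_nonneg_right (mul_le_mul_of_nonneg_left (Real.exp_le_exp.2 ?_) hD.le)
      (norm_nonneg _)
    nlinarith
  have hpert := norm_sub_orderedProd_mul_exp_le (P := Pr) (A := Aᵀ) (t := S.t) (n := n)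
    (fun j X => norm_kerProjMatrix_mul_le _ X) hκ0
    (fun j X => hexp X _ _ (sub_nonneg.2 (S.t_strictMono (Nat.lt_succ_self j)).le)
      (hconn.t_succ_sub_le j)) hη0 hη1 (z := fun j => Z (S.t j)) hstep
  have hlen : ∀ q, jk ((q + 1) * K) - jk (q * K) ≤ L := fun q => by
    have := hconn.sub_le (q * K) K
    rw [← Nat.succ_mul] at this
    exact_mod_cast this.trans hL
  have hjkle : ∀ q, jk (q * K) ≤ jk ((q + 1) * K) := fun q =>
    hconn.strictMono.monotone (Nat.mul_le_mul_right _ (Nat.le_succ q))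
  refine fun s hs => norm_le_of_contraction hconn hK1 (c := κ' * (κ + 1) ^ L) (by positivity)
    ?_ ?_ hs
  · intro q
    have h1 := (hpert (jk (q * K)) (jk ((q + 1) * K) - jk (q * K))).2
    rw [Nat.add_sub_cancel' (hjkle q)] at h1
    set l := jk ((q + 1) * K) - jk (q * K) with hl
    set R := S.t (jk ((q + 1) * K)) - S.t (jk (q * K)) with hR
    have hR0 : 0 ≤ R := sub_nonneg.2 (S.t_strictMono.monotone (hjkle q))
    have hRK : R ≤ K * Tc := by
      have := hconn.t_sub_le (q * K) K
      rwa [← Nat.succ_mul] at this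
    have h2 : ‖orderedProd Pr (jk (q * K)) l * Z (S.t (jk (q * K)))‖ ≤
        δ ^ K * ‖Z (S.t (jk (q * K)))‖ := by
      refine (frobenius_norm_mul_le_opNorm _ _).trans ?_
      refine mul_le_mul_of_nonneg_right ?_ (norm_nonneg _)
      rw [map_orderedProd]
      simp only [hPr, toEuclideanCLM_kerProjMatrix]
      have := norm_orderedProd_kerProj_le_pow hconn hδ0.le hδ (q * K) K
      rwa [← Nat.succ_mul] at this
    have h3 : ‖orderedProd Pr (jk (q * K)) l * Z (S.t (jk (q * K))) *
        NormedSpace.exp (R • Aᵀ)‖ ≤ 1 / 4 * ‖Z (S.t (jk (q * K)))‖ := by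
      refine (hexp _ R (K * Tc) hR0 hRK).trans ?_
      calc _ ≤ C * Real.exp (ρ * (K * Tc)) * (δ ^ K * ‖Z (S.t (jk (q * K)))‖) := by gcongr
        _ = C * (δ * Real.exp (ρ * Tc)) ^ K * ‖Z (S.t (jk (q * K)))‖ := by
          have : ρ * (K * Tc) = K * (ρ * Tc) := by ring
          rw [mul_pow, ← Real.exp_nat_mul, this]; ring
        _ ≤ C * (1 / (4 * C)) * ‖Z (S.t (jk (q * K)))‖ := by gcongr
        _ = _ := by field_simp
    have h4 : η * l * (κ + 1) ^ l ≤ 1 / 4 := by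
      have e1 : (l : ℝ) * (κ + 1) ^ l ≤ L * (κ + 1) ^ L := by
        have : (l : ℝ) ≤ L := by exact_mod_cast hlen q
        have := pow_le_pow_right₀ (show 1 ≤ κ + 1 by linarith) (hlen q)
        gcongr
      have e2 : η * (l * (κ + 1) ^ l) ≤ η * (L * (κ + 1) ^ L) := by gcongr
      have e3 : η * Θ = 4 * (η * (L * (κ + 1) ^ L)) + η := by rw [hΘ]; ring
      rw [mul_assoc]
      linarith
    calc ‖Z (S.t (jk ((q + 1) * K)))‖ ≤ _ := norm_le_norm_sub_add _
          (orderedProd Pr (jk (q * K)) l * Z (S.t (jk (q * K))) * NormedSpace.exp (R • Aᵀ))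
      _ ≤ 1 / 4 * ‖Z (S.t (jk (q * K)))‖ + 1 / 4 * ‖Z (S.t (jk (q * K)))‖ :=
        add_le_add (h1.trans (by gcongr)) h3
      _ = _ := by ring
  · intro q s hs
    obtain ⟨j, hj⟩ := S.exists_mem_Ico ((S.t_nonneg _).trans hs.1)
    have hqj : jk (q * K) ≤ j := Nat.lt_succ_iff.1 (S.t_strictMono.lt_iff_lt.1 (hs.1.trans_lt hj.2))
    have hjq : j < jk ((q + 1) * K) := S.t_strictMono.lt_iff_lt.1 (hj.1.trans_lt hs.2)
    have h1 := (hpert (jk (q * K)) (j - jk (q * K))).1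
    rw [Nat.add_sub_cancel' hqj] at h1
    have h2 : (κ + 1) ^ (j - jk (q * K)) ≤ (κ + 1) ^ L :=
      pow_le_pow_right₀ (by linarith) (by have := hlen q; omega)
    have hs' : s ∈ Set.Icc (S.t j) (S.t (j + 1)) := ⟨hj.1, hj.2.le⟩
    have h3 : ‖Pr j * Z s‖ ≤ κ * ‖Z (S.t j)‖ := by
      rw [hkern j s hs']
      refine (hexp _ _ Tc (sub_nonneg.2 hj.1) ?_).trans
        (mul_le_mul_of_nonneg_left (norm_kerProjMatrix_mul_le _ _) hκ0)
      linarith [hj.2, hconn.t_succ_sub_le j]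
    have h4 : ‖(1 - Pr j) * Z s‖ ≤ D * Real.exp (α * S.τ / 2) * ‖Z (S.t j)‖ := by
      refine (hcompl j s hs').trans ?_
      refine mul_le_mul_of_nonneg_right (mul_le_mul_of_nonneg_left (Real.exp_le_exp.2 ?_) hD.le)
        (norm_nonneg _)
      nlinarith [hj.1]
    calc ‖Z s‖ ≤ ‖Pr j * Z s‖ + ‖(1 - Pr j) * Z s‖ := by
          conv_lhs => rw [hsplit j s]
          exact norm_add_le _ _
      _ ≤ κ' * ‖Z (S.t j)‖ := by rw [hκ', add_mul]; exact add_le_add h3 h4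
      _ ≤ κ' * ((κ + 1) ^ L * ‖Z (S.t (jk (q * K)))‖) := by
        have : 0 ≤ κ' := by positivity
        gcongr
        exact h1.trans (by gcongr)
      _ = _ := by ring

end Decay

/-! ### Solutions of switched linear systems -/

section Existence

theorem exp_sub_self_smul_apply {E : Type*} [NormedAddCommGroup E] [NormedSpace ℝ E]
    (T : E →L[ℝ] E) (v : E) (a : ℝ) : NormedSpace.exp ((a - a) • T) v = v := by
  simp

variable {E : Type*} [NormedAddCommGroup E] [NormedSpace ℝ E] [CompleteSpace E]

theorem hasDerivAt_exp_smul_apply_vec (T : E →L[ℝ] E) (v : E) (a s : ℝ) :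
    HasDerivAt (fun r : ℝ => NormedSpace.exp ((r - a) • T) v)
      (T (NormedSpace.exp ((s - a) • T) v)) s := by
  have h1 := (hasDerivAt_exp_smul_const' (𝕂 := ℝ) T (s - a)).scomp s ((hasDerivAt_id' s).sub_const a)
  have h2 := ((ContinuousLinearMap.apply ℝ E v).hasFDerivAt).comp_hasDerivAt s h1
  simpa [Function.comp_def] using h2

/-- Switched linear systems have solutions on `[0, ∞)`. -/
theorem SwitchingSignal.exists_solution {P : Type*} (S : SwitchingSignal P) (T : ℕ → E →L[ℝ] E)
    (ξ : E) : ∃ z : ℝ → E, ContinuousOn z (Set.Ici 0) ∧ z 0 = ξ ∧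
      ∀ j, ∀ s ∈ Set.Ico (S.t j) (S.t (j + 1)),
        HasDerivWithinAt z (T j (z s)) (Set.Ico (S.t j) (S.t (j + 1))) s := by
  classical
  let X : ℕ → E := fun j => Nat.rec ξ
    (fun j v => NormedSpace.exp ((S.t (j + 1) - S.t j) • T j) v) j
  have hX : ∀ j, X (j + 1) = NormedSpace.exp ((S.t (j + 1) - S.t j) • T j) (X j) := fun j => rfl
  -- The index of the interval containing `s`; the default `0` is taken only for `s < 0`.
  let J : ℝ → ℕ := fun s =>
    if h : ∃ j, s ∈ Set.Ico (S.t j) (S.t (j + 1)) then Classical.choose h else 0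
  have hJ : ∀ j, ∀ s ∈ Set.Ico (S.t j) (S.t (j + 1)), J s = j := by
    intro j s hs
    have h : ∃ j, s ∈ Set.Ico (S.t j) (S.t (j + 1)) := ⟨j, hs⟩
    have h1 : J s = Classical.choose h := dif_pos h
    have h2 := Classical.choose_spec h
    rw [h1]
    have h3 := S.t_strictMono.lt_iff_lt.1 (h2.1.trans_lt hs.2)
    have h4 := S.t_strictMono.lt_iff_lt.1 (hs.1.trans_lt h2.2)
    omega
  let φ : ℕ → ℝ → E := fun j s => NormedSpace.exp ((s - S.t j) • T j) (X j)
  have hφ : ∀ j s, HasDerivAt (φ j) (T j (φ j s)) s := fun j s =>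
    hasDerivAt_exp_smul_apply_vec (T j) (X j) (S.t j) s
  let z : ℝ → E := fun s => φ (J s) s
  have hz : ∀ j, ∀ s ∈ Set.Ico (S.t j) (S.t (j + 1)), z s = φ j s := fun j s hs => by
    simp only [z, hJ j s hs]
  have hzt : ∀ j, z (S.t j) = X j := fun j => by
    rw [hz j _ ⟨le_rfl, S.t_strictMono (Nat.lt_succ_self j)⟩]
    exact exp_sub_self_smul_apply (T j) (X j) (S.t j)
  have hzc : ∀ j, ContinuousOn z (Set.Icc (S.t j) (S.t (j + 1))) := by
    intro j
    refine ContinuousOn.congr (f := φ j) (fun s _ => (hφ j s).continuousAt.continuousWithinAt) ?_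
    intro s hs
    rcases hs.2.lt_or_eq with h | rfl
    · exact hz j s ⟨hs.1, h⟩
    · rw [hzt, hX]
  have hzc0 : ∀ j, ContinuousOn z (Set.Icc 0 (S.t j)) := by
    intro j
    induction j with
    | zero => simp [S.t_zero]
    | succ j ih =>
      rw [← Set.Icc_union_Icc_eq_Icc (S.t_nonneg j) (S.t_strictMono (Nat.lt_succ_self j)).le]
      exact ih.union_of_isClosed (hzc j) isClosed_Icc isClosed_Icc
  refine ⟨z, fun s hs => ?_, ?_, fun j s hs => ?_⟩
  · obtain ⟨j, hj⟩ := S.exists_mem_Ico hs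
    exact (hzc0 (j + 1) s ⟨hs, hj.2.le⟩).mono_of_mem_nhdsWithin
      (Filter.inter_mem self_mem_nhdsWithin (mem_nhdsWithin_of_mem_nhds (Iic_mem_nhds hj.2)))
  · have := hzt 0
    rwa [S.t_zero] at this
  · rw [hz j s hs]
    exact ((hφ j s).hasDerivWithinAt).congr (hz j) (hz j s hs)

end Existence

/-! ### From the closed-loop system to the error equation -/

section ClosedLoop

variable {N n m : ℕ}

/-- Feedback sees only relative states, so agent states may be replaced by errors, with `0` for the
leader. -/
theorem feedback_congr (G : Digraph (Fin (N + 1))) (K : Matrix (Fin m) (Fin n) ℝ)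
    {x y : Fin (N + 1) → EuclideanSpace ℝ (Fin n)} (h : ∀ i j, x j - x i = y j - y i) (i : Fin N) :
    feedback G K x i = feedback G K y i := by
  simp only [feedback, h]

/-- The vector field of the error equation. -/
def errorField (G : Digraph (Fin (N + 1))) (A : Matrix (Fin n) (Fin n) ℝ)
    (B : Matrix (Fin n) (Fin m) ℝ) (K : Matrix (Fin m) (Fin n) ℝ) :
    (Fin N → EuclideanSpace ℝ (Fin n)) →ₗ[ℝ] (Fin N → EuclideanSpace ℝ (Fin n)) :=
  let π : Fin (N + 1) → (Fin N → EuclideanSpace ℝ (Fin n)) →ₗ[ℝ] EuclideanSpace ℝ (Fin n) :=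
    Fin.cons 0 fun i => LinearMap.proj i
  LinearMap.pi fun i => Matrix.toEuclideanLin A ∘ₗ LinearMap.proj i +
    Matrix.toEuclideanLin B ∘ₗ Matrix.toEuclideanLin K ∘ₗ
      ∑ j, adjacency G i.succ j • (π j - π i.succ)

theorem errorField_apply (G : Digraph (Fin (N + 1))) (A : Matrix (Fin n) (Fin n) ℝ)
    (B : Matrix (Fin n) (Fin m) ℝ) (K : Matrix (Fin m) (Fin n) ℝ)
    (e : Fin N → EuclideanSpace ℝ (Fin n)) (i : Fin N) :
    errorField G A B K e i = Matrix.toEuclideanLin A (e i) + Matrix.toEuclideanLin B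
      (feedback G K (Fin.cons 0 e : Fin (N + 1) → EuclideanSpace ℝ (Fin n)) i) := by
  simp [errorField, feedback, Fin.sum_univ_succ]

/-- The leader evolves autonomously and the errors satisfy a switched linear system of their own;
each follower is the leader plus its error. -/
theorem exists_isClosedLoopSolution {P : Type*} (S : SwitchingSignal P)
    (G : P → Digraph (Fin (N + 1))) (A : Matrix (Fin n) (Fin n) ℝ)
    (B : Matrix (Fin n) (Fin m) ℝ) (K : Matrix (Fin m) (Fin n) ℝ)
    (ξ : Fin (N + 1) → EuclideanSpace ℝ (Fin n)) :
    ∃ x, IsClosedLoopSolution S G A B K x ∧ ∀ i, x i 0 = ξ i := by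
  obtain ⟨e, hec, he0, hed⟩ := S.exists_solution
    (fun j => (errorField (G (S.σ (S.t j))) A B K).toContinuousLinearMap) fun i => ξ i.succ - ξ 0
  set A' := (Matrix.toEuclideanLin A).toContinuousLinearMap with hA'
  set y : ℝ → EuclideanSpace ℝ (Fin n) := fun s => NormedSpace.exp ((s - 0) • A') (ξ 0) with hy
  have hyd : ∀ s, HasDerivAt y (Matrix.toEuclideanLin A (y s)) s := fun s =>
    hasDerivAt_exp_smul_apply_vec A' (ξ 0) 0 s
  have hyc : Continuous y := continuous_iff_continuousAt.2 fun s => (hyd s).continuousAt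
  have hy0 : y 0 = ξ 0 := by
    exact exp_sub_self_smul_apply A' (ξ 0) 0
  refine ⟨Fin.cons y fun i s => y s + e s i, ⟨fun i => ?_, fun s _ => ?_, fun i j s hs => ?_⟩,
    fun i => ?_⟩
  · refine Fin.cases ?_ (fun i => ?_) i
    · exact hyc.continuousOn
    · exact hyc.continuousOn.add ((continuous_apply i).comp_continuousOn hec)
  · exact (hyd s).hasDerivWithinAt
  · simp only [Fin.cons_succ]
    have h1 := hasDerivWithinAt_pi.1 (hed j s hs) i
    refine ((hyd s).hasDerivWithinAt.add h1).congr_deriv ?_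
    rw [LinearMap.coe_toContinuousLinearMap', errorField_apply, map_add, add_assoc, S.const j s hs]
    congr 3
    refine feedback_congr _ _ (fun a b => ?_) i
    refine Fin.cases ?_ (fun a => ?_) a <;> refine Fin.cases ?_ (fun b => ?_) b <;> simp
  · refine Fin.cases ?_ (fun i => ?_) i
    · exact hy0
    · simp [hy0, he0]

/-- The matrix whose rows are the consensus errors of the followers. -/
def errorMatrix (x : Fin (N + 1) → ℝ → EuclideanSpace ℝ (Fin n)) (s : ℝ) :
    Matrix (Fin N) (Fin n) ℝ :=
  Matrix.of fun i k => x i.succ s k - x 0 s k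

theorem sum_adjacency_smul_sub_apply (G : Digraph (Fin (N + 1)))
    (x : Fin (N + 1) → ℝ → EuclideanSpace ℝ (Fin n)) (s : ℝ) (i : Fin N) (k : Fin n) :
    (∑ j, adjacency G i.succ j • (x j s - x i.succ s)) k =
      -(leaderFollowerMatrix G * errorMatrix x s) i k := by
  have h := leaderFollowerMatrix_mulVec_apply G (fun i => errorMatrix x s i k) i
  have h2 : (leaderFollowerMatrix G * errorMatrix x s) i k =
      (leaderFollowerMatrix G *ᵥ fun i => errorMatrix x s i k) i := by
    rw [Matrix.mul_apply]; rfl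
  rw [h2, h, Fin.sum_univ_succ, PiLp.add_apply, neg_add, add_comm]
  congr 1
  · rw [WithLp.ofLp_sum, Finset.sum_apply, ← Finset.sum_neg_distrib]
    refine Finset.sum_congr rfl fun j _ => ?_
    have h3 : adjacency (followerSubgraph G) i j = adjacency G i.succ j.succ := rfl
    rw [h3]
    simp only [PiLp.smul_apply, PiLp.sub_apply, smul_eq_mul, errorMatrix, of_apply]
    ring
  · simp only [PiLp.smul_apply, PiLp.sub_apply, smul_eq_mul, errorMatrix, of_apply]
    ring

theorem IsClosedLoopSolution.solvesErrorEquation {P : Type*} {S : SwitchingSignal P}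
    {G : P → Digraph (Fin (N + 1))} {A : Matrix (Fin n) (Fin n) ℝ}
    {B : Matrix (Fin n) (Fin m) ℝ} {K : Matrix (Fin m) (Fin n) ℝ}
    {x : Fin (N + 1) → ℝ → EuclideanSpace ℝ (Fin n)} (hx : IsClosedLoopSolution S G A B K x)
    (j : ℕ) : SolvesErrorEquation A (B * K) (leaderFollowerMatrix (G (S.σ (S.t j))))
      (errorMatrix x) (S.t j) (S.t (j + 1)) where
  continuousOn i k := by
    have h : ∀ l, ContinuousOn (fun r => x l r k) (Set.Icc (S.t j) (S.t (j + 1))) := fun l =>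
      ((EuclideanSpace.proj (𝕜 := ℝ) k).continuous.comp_continuousOn (hx.continuousOn l)).mono
        fun r hr => (S.t_nonneg j).trans hr.1
    exact (h i.succ).sub (h 0)
  hasDerivWithinAt s hs i k := by
    have hs0 : 0 ≤ s := (S.t_nonneg j).trans hs.1
    have h0 := (hx.leader s hs0).mono (Set.Ici_subset_Ici.2 hs0)
    have h1 := (hx.follower i j s hs).mono_of_mem_nhdsWithin (s := Set.Ici s)
      (Filter.mem_of_superset (Ico_mem_nhdsGE hs.2) (Set.Ico_subset_Ico_left hs.1))
    have h0' := (EuclideanSpace.proj (𝕜 := ℝ) k).hasFDerivAt.comp_hasDerivWithinAt s h0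
    have h1' := (EuclideanSpace.proj (𝕜 := ℝ) k).hasFDerivAt.comp_hasDerivWithinAt s h1
    refine (h1'.sub h0').congr_deriv ?_
    rw [S.const j s hs]
    have hproj : ∀ v : EuclideanSpace ℝ (Fin n), EuclideanSpace.proj (𝕜 := ℝ) k v = v k :=
      fun _ => rfl
    simp only [hproj, PiLp.add_apply, feedback, Matrix.toLpLin_apply,
      Matrix.mulVec_mulVec]
    have h2 : (A *ᵥ (x i.succ s).ofLp) k - (A *ᵥ (x 0 s).ofLp) k = (errorMatrix x s * Aᵀ) i k := by
      rw [← Pi.sub_apply, ← Matrix.mulVec_sub, Matrix.mul_apply, mulVec, dotProduct]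
      refine Finset.sum_congr rfl fun l _ => ?_
      rw [mul_comm]; rfl
    have h3 : ((B * K) *ᵥ (∑ l, adjacency (G (S.σ (S.t j))) i.succ l •
        (x l s - x i.succ s)).ofLp) k =
        -(leaderFollowerMatrix (G (S.σ (S.t j))) * errorMatrix x s * (B * K)ᵀ) i k := by
      rw [Matrix.mul_apply, mulVec, dotProduct, ← Finset.sum_neg_distrib]
      refine Finset.sum_congr rfl fun l _ => ?_
      rw [sum_adjacency_smul_sub_apply, Matrix.transpose_apply]
      ring
    rw [Matrix.sub_apply]
    linarith

open scoped Matrix.Norms.Frobenius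

theorem norm_errorMatrix_sq (x : Fin (N + 1) → ℝ → EuclideanSpace ℝ (Fin n)) (s : ℝ) :
    ‖errorMatrix x s‖ ^ 2 = ∑ i : Fin N, ‖x i.succ s - x 0 s‖ ^ 2 := by
  rw [frobenius_norm_sq]
  refine Finset.sum_congr rfl fun i _ => ?_
  rw [EuclideanSpace.norm_sq_eq]
  simp [errorMatrix]

/-- The Frobenius norm of the error matrix dominates each row, and at time `0` it is exactly the
square root in the consensus estimate. -/
theorem solvesConsensus_of_norm_errorMatrix_le {P : Type*} {S : SwitchingSignal P}
    {G : P → Digraph (Fin (N + 1))} {A : Matrix (Fin n) (Fin n) ℝ}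
    {B : Matrix (Fin n) (Fin m) ℝ} {K : Matrix (Fin m) (Fin n) ℝ}
    (h : ∃ c > 0, ∃ γ > 0, ∀ Z : ℝ → Matrix (Fin N) (Fin n) ℝ,
      (∀ j, SolvesErrorEquation A (B * K) (leaderFollowerMatrix (G (S.σ (S.t j)))) Z
        (S.t j) (S.t (j + 1))) →
      ∀ s, 0 ≤ s → ‖Z s‖ ≤ c * Real.exp (-γ * s) * ‖Z 0‖) :
    SolvesConsensus S G A B K := by
  refine ⟨exists_isClosedLoopSolution S G A B K, ?_⟩
  obtain ⟨c, hc, γ, hγ, h⟩ := h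
  refine ⟨c, hc, γ, hγ, fun x hx i s hs => ?_⟩
  have h1 := h (errorMatrix x) hx.solvesErrorEquation s hs
  rw [← norm_errorMatrix_sq, Real.sqrt_sq (norm_nonneg _)]
  refine le_trans (le_of_sq_le_sq ?_ (norm_nonneg _)) h1
  rw [norm_errorMatrix_sq]
  exact Finset.single_le_sum (f := fun i : Fin N => ‖x i.succ s - x 0 s‖ ^ 2)
    (fun _ _ => sq_nonneg _) (Finset.mem_univ i)

end ClosedLoop

end LeaderFollowing

end

/-! ### Main theorem -/

theorem theorem1 {N n m n₀ : ℕ}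
    (A : Matrix (Fin n) (Fin n) ℝ) (B : Matrix (Fin n) (Fin m) ℝ)
    (S : LeaderFollowing.SwitchingSignal (Fin n₀))
    (G : Fin n₀ → Digraph (Fin (N + 1)))
    (hloop : ∀ p i, ¬ (G p).Adj i i)
    (hctrl : LeaderFollowing.Controllable A B)
    (hundir : ∀ s : ℝ, 0 ≤ s →
      LeaderFollowing.IsUndirected (LeaderFollowing.followerSubgraph (G (S.σ s))))
    (jk : ℕ → ℕ) (Tc : ℝ)
    (hconn : LeaderFollowing.JointlyConnected S G jk Tc) :
    (∃ δ : ℝ, 0 < δ ∧ δ < 1 ∧ LeaderFollowing.ProjectionProductsBounded S G jk δ) ∧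
    ∀ δ : ℝ, 0 < δ → δ < 1 → LeaderFollowing.ProjectionProductsBounded S G jk δ →
      LeaderFollowing.lambdaMax A < -(Real.log δ) / Tc →
      (∃ K : Matrix (Fin m) (Fin n) ℝ, LeaderFollowing.SolvesConsensus S G A B K) ∧
      ∀ tstar : ℝ, 0 < tstar → ∃ α₀ : ℝ, 0 < α₀ ∧ ∀ α : ℝ, α₀ < α →
        (LeaderFollowing.gramian A B α tstar).PosDef ∧
        ∀ μ : ℝ, 1 / LeaderFollowing.lambdaH N ≤ μ →
          LeaderFollowing.SolvesConsensus S G A B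
            (μ • (B.transpose * (LeaderFollowing.gramian A B α tstar)⁻¹)) := by
  have hundir' := fun j => hundir (S.t j) (S.t_nonneg j)
  refine ⟨LeaderFollowing.exists_projectionProductsBounded hundir' hconn, ?_⟩
  intro δ hδ0 hδ1 hδ hA
  have main : ∀ tstar : ℝ, 0 < tstar → ∃ α₀ : ℝ, 0 < α₀ ∧ ∀ α : ℝ, α₀ < α →
      (LeaderFollowing.gramian A B α tstar).PosDef ∧
      ∀ μ : ℝ, 1 / LeaderFollowing.lambdaH N ≤ μ →
        LeaderFollowing.SolvesConsensus S G A B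
          (μ • (B.transpose * (LeaderFollowing.gramian A B α tstar)⁻¹)) := by
    intro tstar htstar
    obtain ⟨α₀, hα₀, h⟩ := LeaderFollowing.exists_norm_le_mul_exp_mul hloop hctrl hundir' hconn
      hδ0 hδ1 hδ hA htstar
    exact ⟨α₀, hα₀, fun α hα => ⟨LeaderFollowing.gramian_posDef hctrl α htstar, fun μ hμ =>
      LeaderFollowing.solvesConsensus_of_norm_errorMatrix_le (h α hα μ hμ)⟩⟩
  refine ⟨?_, main⟩
  -- Any horizon works for mere existence; here `t* = 1`, `α = α₀ + 1` and `μ = 1 / λ_H`.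
  obtain ⟨α₀, _, h⟩ := main 1 one_pos
  exact ⟨_, (h (α₀ + 1) (lt_add_one α₀)).2 _ le_rfl⟩
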